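/- **Setting.** Fix spaces $\mathcal X,\mathcal Y$ of plaintexts and outputs and a space $\mathcal F$ of functions $f:\mathcal X\to\mathcal Y$ (all depending on the security parameter $\lambda$, with elements represented by bit strings whose length depends only on $\lambda$). Let $\mathsf{PKFE}=(\mathsf{Setup},\mathsf{KG},\mathsf{Enc},\mathsf{Dec})$ be a public-key functional encryption scheme for $\mathcal X,\mathcal Y,\mathcal F$ with PPT algorithms, and let $\mathsf{SDE}=(\mathsf{Setup},\mathcal{QKG},\mathsf{Enc},\mathcal{D}ec)$ be a single-decryptor encryption scheme whose message space is the ciphertext space of $\mathsf{PKFE}$ ($\mathsf{Setup},\mathsf{Enc}$ are classical PPT; $\mathcal{QKG}$, which outputs a quantum key, and $\mathcal{D}ec$ are QPT). The nested single-decryptor functional encryption scheme $\mathsf{1SDFE}$ is: - $\mathsf{Setup}(1^\lambda)$: $(\mathsf{fe.pk},\mathsf{fe.msk})\gets\mathsf{PKFE.Setup}(1^\lambda)$, $(\mathsf{sde.pk},\mathsf{sde.sk})\gets\mathsf{SDE.Setup}(1^\lambda)$; output $\mathsf{pk}=(\mathsf{fe.pk},\mathsf{sde.pk})$, $\mathsf{msk}=(\mathsf{fe.msk},\mathsf{sde.sk})$.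 - $\mathcal{QKG}(\mathsf{msk},f)$: output $(\mathsf{fe.sk}_f,\mathit{dk})$ with $\mathsf{fe.sk}_f\gets\mathsf{PKFE.KG}(\mathsf{fe.msk},f)$ and $\mathit{dk}\gets\mathsf{SDE}.\mathcal{QKG}(\mathsf{sde.sk})$. - $\mathsf{Enc}(\mathsf{pk},x)$: output $\mathsf{SDE.Enc}(\mathsf{sde.pk},\mathsf{PKFE.Enc}(\mathsf{fe.pk},x))$. - $\mathcal{D}ec((\mathsf{fe.sk}_f,\mathit{dk}),\mathsf{ct})$: decrypt $\mathsf{ct}$ with $\mathit{dk}$, then decrypt the result with $\mathsf{fe.sk}_f$. **$\gamma$-good test.** A quantum decryptor is a pair $(q,U)$ of a quantum state $q$ and (the classical description of) a general quantum circuit $U$ that takes a ciphertext and $q$ and outputs a bit. Let $D$ be a distribution on pairs $(\mathsf{coin},\mathsf{ct})$. Let $P$ be the operator for which $\mathrm{Tr}(Pq)$ is the probability that $U$, run on $\mathsf{ct}$ and $q$ with $(\mathsf{coin},\mathsf{ct})\gets D$, outputs $\mathsf{coin}$. The test with respect to $D$ is the threshold implementation of $(P,I-P)$ with threshold $\frac12+\gamma$: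 measure $q$ with the spectral projections of $P$ and pass if the eigenvalue obtained is at least $\frac12+\gamma$. **SDE game with randomized function family $\mathcal G=\{\mathcal G_\lambda\}_\lambda$.** The challenger runs $(\mathsf{pk},\mathsf{sk})\gets\mathsf{Setup}(1^\lambda)$ and gives $\mathsf{pk}$ and $\mathit{dk}\gets\mathcal{QKG}(\mathsf{sk})$ to the adversary, who outputs inputs $m_0,m_1$ with $|m_0|=|m_1|$, a $g\in\mathcal G_\lambda$, and two decryptors $(q[R_1],U_1)$, $(q[R_2],U_2)$, where $q$ is a possibly entangled state on registers $R_1,R_2$. The adversary wins if both decryptors pass the $\gamma$-good test with respect to the distribution of $(\mathsf{coin},\mathsf{Enc}(\mathsf{pk},g(m_{\mathsf{coin}};r)))$ with uniform $\mathsf{coin}\in\{0,1\}$ and uniform $r$. $\mathsf{SDE}$ is *strong $\gamma$-anti-piracy secure with randomized function family $\mathcal G$* if every QPT adversary wins with negligible probability. **Challenge-only SDFE game.** The challenger runs $(\mathsf{pk},\mathsf{msk})\gets\mathsf{Setup}(1^\lambda)$ and gives $\mathsf{pk}$ to the adversary, who sends one query $f^*\in\mathcal F$, receives $\mathcal{QKG}(\mathsf{msk},f^*)$,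 and outputs $x_0,x_1\in\mathcal X$ with $f^*(x_0)\ne f^*(x_1)$ and two decryptors $(q[R_1],U_1)$, $(q[R_2],U_2)$ as above. The adversary wins if both decryptors pass the $\gamma$-good test with respect to the distribution of $(\mathsf{coin},\mathsf{Enc}(\mathsf{pk},x_{\mathsf{coin}}))$ with uniform $\mathsf{coin}\in\{0,1\}$. The scheme is *challenge-only strong $\gamma$-anti-piracy secure* if every QPT adversary wins with negligible probability. **Theorem.** Let $\gamma,\gamma':\mathbb N\to[0,1]$ with $\gamma'(\lambda)\le\gamma(\lambda)$ for all $\lambda$ (for instance $\gamma'=\gamma/4$ or $\gamma'=\gamma$). If $\mathsf{SDE}$ is strong $\gamma'$-anti-piracy secure with the randomized function family $\mathcal G_\lambda=\{\mathsf{PKFE.Enc}(\mathsf{fe.pk},\cdot\,;\cdot) : \mathsf{fe.pk}\text{ in the support of }\mathsf{PKFE.Setup}(1^\lambda)\}$ on inputs from $\mathcal X$, then $\mathsf{1SDFE}$ is challenge-only strong $\gamma$-anti-piracy secure. -/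

import Mathlib

open scoped BigOperators Kronecker

noncomputable section

namespace QCrypto

/-! ## Registers and circuits -/

/-- The shape of a register: a bracketed sequence of (qu)bits. -/
inductive Wires : Type
  | unit : Wires
  | bit : Wires
  | tensor : Wires → Wires → Wires

infixr:70 " ⊠ " => Wires.tensor

/-- The classical contents of a register, i.e. the bit strings of that shape. They index the
computational basis of the register. -/
@[reducible] def Wires.val : Wires → Type
  | .unit => Unit
  | .bit => Bool
  | .tensor a b => a.val × b.val

@[reducible] def Wires.valFintype : (w : Wires) → Fintype w.val
  | .unit => inferInstanceAs (Fintype Unit)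
  | .bit => inferInstanceAs (Fintype Bool)
  | .tensor a b => @instFintypeProd _ _ a.valFintype b.valFintype

@[reducible] def Wires.valDecEq : (w : Wires) → DecidableEq w.val
  | .unit => inferInstanceAs (DecidableEq Unit)
  | .bit => inferInstanceAs (DecidableEq Bool)
  | .tensor a b => @instDecidableEqProd _ _ a.valDecEq b.valDecEq

instance (w : Wires) : Fintype w.val := w.valFintype

instance (w : Wires) : DecidableEq w.val := w.valDecEq

/-- The number of (qu)bits of a register. -/
def Wires.width : Wires → ℕ
  | .unit => 0
  | .bit => 1
  | .tensor a b => a.width + b.width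

/-- The contents of a register as a flat bit string. -/
def Wires.toBits : (w : Wires) → w.val → List Bool
  | .unit, _ => []
  | .bit, b => [b]
  | .tensor a b, x => a.toBits x.1 ++ b.toBits x.2

/-- Circuits over a gate set `G`: gates composed in sequence and in parallel, with rewiring. -/
inductive Circ (G : Wires → Wires → Type) : Wires → Wires → Type
  | id (a : Wires) : Circ G a a
  | seq {a b c : Wires} (f : Circ G a b) (g : Circ G b c) : Circ G a c
  | par {a b c d : Wires} (f : Circ G a b) (g : Circ G c d) : Circ G (a ⊠ c) (b ⊠ d)
  | swap (a b : Wires) : Circ G (a ⊠ b) (b ⊠ a)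
  | assoc (a b c : Wires) : Circ G ((a ⊠ b) ⊠ c) (a ⊠ (b ⊠ c))
  | assocInv (a b c : Wires) : Circ G (a ⊠ (b ⊠ c)) ((a ⊠ b) ⊠ c)
  | unitL (a : Wires) : Circ G (Wires.unit ⊠ a) a
  | unitLInv (a : Wires) : Circ G a (Wires.unit ⊠ a)
  | gate {a b : Wires} (g : G a b) : Circ G a b

/-- The number of elementary gates of a circuit, for a given cost of each gate. -/
def Circ.sizeWith {G : Wires → Wires → Type} (cost : ∀ a b, G a b → ℕ) :
    {a b : Wires} → Circ G a b → ℕ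
  | _, _, .seq f g => f.sizeWith cost + g.sizeWith cost
  | _, _, .par f g => f.sizeWith cost + g.sizeWith cost
  | a, b, .gate g => cost a b g
  | _, _, _ => 0

/-- The description of a circuit as a bit string. It is a prefix code: the shape of the input
register and the string determine the circuit. -/
def Circ.codeWith {G : Wires → Wires → Type} (gcode : ∀ a b, G a b → List Bool) :
    {a b : Wires} → Circ G a b → List Bool
  | _, _, .id _ => [false, false, false, false]
  | _, _, .seq f g => [false, false, false, true] ++ (f.codeWith gcode ++ g.codeWith gcode)
  | _, _, .par f g => [false, false, true, false] ++ (f.codeWith gcode ++ g.codeWith gcode)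
  | _, _, .swap _ _ => [false, false, true, true]
  | _, _, .assoc _ _ _ => [false, true, false, false]
  | _, _, .assocInv _ _ _ => [false, true, false, true]
  | _, _, .unitL _ => [false, true, true, false]
  | _, _, .unitLInv _ => [false, true, true, true]
  | a, b, .gate g => [true, false, false, false] ++ gcode a b g

/-! ### Boolean circuits -/

/-- Boolean gates; `dup` and `drop` copy and erase a whole register, bit by bit. -/
inductive BGate : Wires → Wires → Type
  | nand : BGate (Wires.bit ⊠ Wires.bit) Wires.bit
  | const (v : Bool) : BGate Wires.unit Wires.bit
  | dup (w : Wires) : BGate w (w ⊠ w)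
  | drop (w : Wires) : BGate w Wires.unit

abbrev BCirc : Wires → Wires → Type := Circ BGate

def BGate.eval : {a b : Wires} → BGate a b → a.val → b.val
  | _, _, .nand => fun x => !(x.1 && x.2)
  | _, _, .const v => fun _ => v
  | _, _, .dup _ => fun x => (x, x)
  | _, _, .drop _ => fun _ => ()

def BGate.cost : (a b : Wires) → BGate a b → ℕ
  | _, _, .nand => 1
  | _, _, .const _ => 1
  | _, _, .dup w => w.width
  | _, _, .drop w => w.width

def BGate.code : (a b : Wires) → BGate a b → List Bool
  | _, _, .nand => [false, false]
  | _, _, .const v => [false, true, v]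
  | _, _, .dup _ => [true, false]
  | _, _, .drop _ => [true, true]

/-- The function computed by a Boolean circuit. -/
def BCirc.eval : {a b : Wires} → BCirc a b → a.val → b.val
  | _, _, .id _ => fun x => x
  | _, _, .seq f g => fun x => BCirc.eval g (BCirc.eval f x)
  | _, _, .par f g => fun x => (BCirc.eval f x.1, BCirc.eval g x.2)
  | _, _, .swap _ _ => fun x => (x.2, x.1)
  | _, _, .assoc _ _ _ => fun x => (x.1.1, (x.1.2, x.2))
  | _, _, .assocInv _ _ _ => fun x => ((x.1, x.2.1), x.2.2)
  | _, _, .unitL _ => fun x => x.2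
  | _, _, .unitLInv _ => fun x => ((), x)
  | _, _, .gate g => g.eval

/-! ### General quantum circuits -/

/-- Gates of general quantum circuits: a universal set of unitary gates, a fair coin, and
`classical c`, which measures its input register in the computational basis and runs the Boolean
circuit `c` on the outcome (so measuring, preparing and discarding qubits are special cases). -/
inductive QGate : Wires → Wires → Type
  | hadamard : QGate Wires.bit Wires.bit
  | phase : QGate Wires.bit Wires.bit
  | cnot : QGate (Wires.bit ⊠ Wires.bit) (Wires.bit ⊠ Wires.bit)
  | coin : QGate Wires.unit Wires.bit
  | classical {a b : Wires} (c : BCirc a b) : QGate a b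

abbrev QCirc : Wires → Wires → Type := Circ QGate

def QGate.cost : (a b : Wires) → QGate a b → ℕ
  | a, _, .classical c => a.width + c.sizeWith BGate.cost
  | _, _, _ => 1

def QGate.code : (a b : Wires) → QGate a b → List Bool
  | _, _, .hadamard => [false, false, false]
  | _, _, .phase => [false, false, true]
  | _, _, .cnot => [false, true, false]
  | _, _, .coin => [false, true, true]
  | _, _, .classical c => [true, false, false] ++ c.codeWith BGate.code

abbrev QCirc.size {a b : Wires} (C : QCirc a b) : ℕ := C.sizeWith QGate.cost

abbrev QCirc.code {a b : Wires} (C : QCirc a b) : List Bool := C.codeWith QGate.code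

theorem Circ.codeWith_inj {G : Wires → Wires → Type} (gc : ∀ a b, G a b → List Bool)
    (hg : ∀ a b (g : G a b) b' (g' : G a b') s s', gc a b g ++ s = gc a b' g' ++ s' →
      b = b' ∧ HEq g g' ∧ s = s') :
    ∀ {a b} (c : Circ G a b) {b'} (c' : Circ G a b') (s s' : List Bool),
      c.codeWith gc ++ s = c'.codeWith gc ++ s' → b = b' ∧ HEq c c' ∧ s = s' := by
  intro a b c
  induction c with
  | seq f g ihf ihg =>
    intro b' c' s s' h
    cases c' <;> simp [Circ.codeWith] at h
    rename_i m f' g'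
    obtain ⟨rfl, h1, h2⟩ := ihf f' _ _ h
    obtain rfl := eq_of_heq h1
    obtain ⟨rfl, h3, h4⟩ := ihg g' _ _ h2
    obtain rfl := eq_of_heq h3
    exact ⟨rfl, HEq.rfl, h4⟩
  | par f g ihf ihg =>
    intro b' c' s s' h
    cases c' <;> simp [Circ.codeWith] at h
    rename_i f' g'
    obtain ⟨rfl, h1, h2⟩ := ihf f' _ _ h
    obtain rfl := eq_of_heq h1
    obtain ⟨rfl, h3, h4⟩ := ihg g' _ _ h2
    obtain rfl := eq_of_heq h3
    exact ⟨rfl, HEq.rfl, h4⟩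
  | gate g =>
    intro b' c' s s' h
    cases c' <;> simp [Circ.codeWith] at h
    obtain ⟨rfl, h1, h2⟩ := hg _ _ _ _ _ _ _ h
    obtain rfl := eq_of_heq h1
    exact ⟨rfl, HEq.rfl, h2⟩
  | _ =>
    intro b' c' s s' h
    cases c' <;> simp [Circ.codeWith] at h
    all_goals exact ⟨rfl, HEq.rfl, h⟩

theorem BGate.code_inj : ∀ a b (g : BGate a b) b' (g' : BGate a b') s s',
    BGate.code a b g ++ s = BGate.code a b' g' ++ s' → b = b' ∧ HEq g g' ∧ s = s' := by
  intro a b g b' g' s s' h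
  cases g <;> cases g' <;> simp [BGate.code] at h
  all_goals first | exact ⟨rfl, HEq.rfl, h⟩ | (obtain ⟨rfl, rfl⟩ := h; exact ⟨rfl, HEq.rfl, rfl⟩)

theorem QGate.code_inj : ∀ a b (g : QGate a b) b' (g' : QGate a b') s s',
    QGate.code a b g ++ s = QGate.code a b' g' ++ s' → b = b' ∧ HEq g g' ∧ s = s' := by
  intro a b g b' g' s s' h
  cases g with
  | classical c =>
    cases g' <;> simp [QGate.code] at h
    rename_i c'
    obtain ⟨rfl, h1, h2⟩ := Circ.codeWith_inj _ BGate.code_inj c c' _ _ h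
    obtain rfl := eq_of_heq h1
    exact ⟨rfl, HEq.rfl, h2⟩
  | _ =>
    cases g' <;> simp [QGate.code] at h
    all_goals exact ⟨rfl, HEq.rfl, h⟩

/-- A bit string describes at most one circuit with given input and output registers. -/
theorem QCirc.code_unique {a b : Wires} (U U' : QCirc a b) (s : List Bool) (h : U.code <+: s)
    (h' : U'.code <+: s) : U = U' := by
  obtain ⟨t, rfl⟩ := h
  obtain ⟨t', h'⟩ := h'
  exact eq_of_heq (Circ.codeWith_inj _ QGate.code_inj U U' _ _ h'.symm).2.1

/-- Operators on (the Hilbert space of) a register, in particular its density matrices. -/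
abbrev Op (w : Wires) : Type := Matrix w.val w.val ℂ

/-- The state `|x⟩⟨x|`. -/
def ket {w : Wires} (x : w.val) : Op w := Matrix.single x x 1

/-- The map `Φ ⊗ id`. -/
def onLeft {α β κ : Type} (Φ : Matrix α α ℂ → Matrix β β ℂ) (ρ : Matrix (α × κ) (α × κ) ℂ) :
    Matrix (β × κ) (β × κ) ℂ :=
  Matrix.of fun p q => Φ (Matrix.of fun i j => ρ (i, p.2) (j, q.2)) p.1 q.1

/-- The map `id ⊗ Φ`. -/
def onRight {α β κ : Type} (Φ : Matrix α α ℂ → Matrix β β ℂ) (ρ : Matrix (κ × α) (κ × α) ℂ) :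
    Matrix (κ × β) (κ × β) ℂ :=
  Matrix.of fun p q => Φ (Matrix.of fun i j => ρ (p.1, i) (q.1, j)) p.2 q.2

def hadamardMatrix : Matrix Bool Bool ℂ :=
  Matrix.of fun x y => ((Real.sqrt 2 : ℝ) : ℂ)⁻¹ * (if x && y then -1 else 1)

def phaseMatrix : Matrix Bool Bool ℂ :=
  Matrix.diagonal fun x => if x then Complex.exp (Complex.I * (Real.pi / 4 : ℝ)) else 1

def QGate.denote : {a b : Wires} → QGate a b → Op a → Op b
  | _, _, .hadamard => fun ρ => hadamardMatrix * ρ * hadamardMatrix.conjTranspose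
  | _, _, .phase => fun ρ => phaseMatrix * ρ * phaseMatrix.conjTranspose
  | _, _, .cnot => fun ρ =>
      Matrix.submatrix ρ (fun x => (x.1, xor x.1 x.2)) (fun x => (x.1, xor x.1 x.2))
  | _, _, .coin => fun ρ => Matrix.diagonal fun _ => ρ () () / 2
  | _, _, .classical c => fun ρ =>
      Matrix.diagonal fun y => ∑ x, if c.eval x = y then ρ x x else 0

/-- The quantum operation performed by a general quantum circuit. -/
def QCirc.denote : {a b : Wires} → QCirc a b → Op a → Op b
  | _, _, .id _ => fun ρ => ρ
  | _, _, .seq f g => fun ρ => QCirc.denote g (QCirc.denote f ρ)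
  | _, _, .par f g => fun ρ => onRight (QCirc.denote g) (onLeft (QCirc.denote f) ρ)
  | _, _, .swap _ _ => fun ρ => Matrix.submatrix ρ (fun x => (x.2, x.1)) (fun x => (x.2, x.1))
  | _, _, .assoc _ _ _ => fun ρ =>
      Matrix.submatrix ρ (fun x => ((x.1, x.2.1), x.2.2)) (fun x => ((x.1, x.2.1), x.2.2))
  | _, _, .assocInv _ _ _ => fun ρ =>
      Matrix.submatrix ρ (fun x => (x.1.1, (x.1.2, x.2))) (fun x => (x.1.1, (x.1.2, x.2)))
  | _, _, .unitL _ => fun ρ => Matrix.submatrix ρ (fun x => ((), x)) (fun x => ((), x))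
  | _, _, .unitLInv _ => fun ρ => Matrix.submatrix ρ (fun x => x.2) (fun x => x.2)
  | _, _, .gate g => g.denote

/-! ## Efficient algorithms -/

/-- A quantum polynomial-time algorithm: a family of general quantum circuits of polynomial size
whose descriptions are computed by a deterministic polynomial-time Turing machine on input `1ⁿ`. -/
def IsQPT {a b : ℕ → Wires} (C : ∀ n, QCirc (a n) (b n)) : Prop :=
  (∃ p : Polynomial ℕ, ∀ n, (a n).width + (C n).size ≤ p.eval n) ∧
    Nonempty (Turing.TM2ComputableInPolyTime Computability.unaryEncodeNat
      (fun l : List Bool => l) (fun n => (C n).code))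

/-- Fill a register with independent fair coins. -/
def coins : (w : Wires) → QCirc Wires.unit w
  | .unit => .id _
  | .bit => .gate .coin
  | .tensor a b => .seq (.unitLInv _) (.par (coins a) (coins b))

/-- Draw the random string `r` uniformly and run a Boolean circuit on the input and `r`. -/
def sample {a r b : Wires} (c : BCirc (a ⊠ r) b) : QCirc a b :=
  .seq (.seq (.unitLInv a) (.swap _ _)) (.seq (.par (.id a) (coins r)) (.gate (.classical c)))

/-- The randomized function family `f`, with explicit random input, is computed by a classical
probabilistic polynomial-time algorithm. -/
def IsPPT {a r b : ℕ → Wires} (f : ∀ n, (a n).val → (r n).val → (b n).val) : Prop :=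
  ∃ c : ∀ n, BCirc (a n ⊠ r n) (b n),
    (∀ n x s, (c n).eval (x, s) = f n x s) ∧ IsQPT fun n => sample (c n)

/-- Representation of `{⊥} ∪ w` by a flag and a string. -/
def toOption {w : Wires} (x : (Wires.bit ⊠ w).val) : Option w.val :=
  if x.1 then some x.2 else none

/-- A function of the security parameter is negligible. -/
def Negligible (f : ℕ → ℝ) : Prop :=
  Asymptotics.SuperpolynomialDecay Filter.atTop (fun n : ℕ => (n : ℝ)) f

/-! ## Threshold implementation -/

/-- The projective implementation of the binary POVM `(P, I - P)`: the projective measurement whose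
outcome is the distribution `(p, 1 - p)`, `p` an eigenvalue of `P`, and whose projection for this
outcome is the spectral projection of `P` onto the eigenspace of `p`. -/
def projImp {w : Wires} (P : Op w) (p : ℝ) : Op w :=
  cfc (fun x : ℝ => if x = p then (1 : ℝ) else 0) P

/-- The threshold implementation of `(P, I - P)`: apply the projective implementation, and accept
if the outcome `(p, 1 - p)` has `p ≥ t`. This is the projection onto the accepting outcome. -/
def thresholdImp {w : Wires} (t : ℝ) (P : Op w) : Op w :=
  ∑ p ∈ (P.finite_real_spectrum).toFinset, if t ≤ p then projImp P p else 0

/-! ## Quantum decryptors and their test -/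

/-- Given the quantum decryptor `(q, U)`, the positive operator `E` with
`Tr (E q) = Pr[U outputs v on input ciphertext ct and state q]`. -/
def decryptorOp {c R : Wires} (U : QCirc (c ⊠ R) Wires.bit) (ct : c.val) (v : Bool) : Op R :=
  Matrix.of fun i j => U.denote (Matrix.single (ct, j) (ct, i) 1) v v

/-- The mixture, over a uniform `ω`, of the measurements "run the decryptor on the ciphertext
`(D ω).2` and accept if it outputs the bit `(D ω).1`" (accepting element of the binary POVM). -/
def mixture {Ω : Type} [Fintype Ω] {c R : Wires} (D : Ω → Bool × c.val)
    (U : QCirc (c ⊠ R) Wires.bit) : Op R :=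
  (Fintype.card Ω : ℂ)⁻¹ • ∑ ω, decryptorOp U (D ω).2 (D ω).1

/-- The circuit described by a (padded) bit string, if any. The padding has to make the string at
least as long as the circuit is large, so that polynomially long strings describe circuits of
polynomial size. -/
def decodeCirc {a b : Wires} (s : List Bool) : Option (QCirc a b) :=
  open Classical in
  if h : ∃ U : QCirc a b, U.code <+: s ∧ U.size ≤ s.length then some h.choose else none

/-- The projection onto passing the `γ`-good test, where ciphertexts and coins are distributed
according to `D` and the circuit of the decryptor is described by `s`. -/
def testProj {Ω : Type} [Fintype Ω] {c : Wires} (R : Wires) (γ : ℝ) (D : Ω → Bool × c.val)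
    (s : List Bool) : Op R :=
  match (decodeCirc s : Option (QCirc (c ⊠ R) Wires.bit)) with
  | some U => thresholdImp (1 / 2 + γ) (mixture D U)
  | none => 0

/-- The (unnormalized) state of the register `b` after measuring the register `a` with outcome
`x`. -/
def condOn {a b : Wires} (ρ : Op (a ⊠ b)) (x : a.val) : Op b :=
  Matrix.submatrix ρ (fun y => (x, y)) (fun y => (x, y))

/-- The probability that both tests pass on the two registers of `q`. -/
def bothPass {R₁ R₂ : Wires} (T₁ : Op R₁) (T₂ : Op R₂) (q : Op (R₁ ⊠ R₂)) : ℝ :=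
  (Matrix.trace ((T₁ ⊗ₖ T₂ : Op (R₁ ⊠ R₂)) * q)).re

/-- Average of a real function over a uniformly random string. -/
def avg {w : Wires} (f : w.val → ℝ) : ℝ := (Fintype.card w.val : ℝ)⁻¹ * ∑ r, f r

/-! ## Schemes -/

/-- A plaintext space `𝒳`, an output space `𝒴` and a function space `ℱ`, given by their string
representations for each security parameter. -/
structure FunClass where
  X : ℕ → Wires
  Y : ℕ → Wires
  F : ℕ → Wires
  plaintexts : ∀ n, Set (X n).val
  functions : ∀ n, Set (F n).val
  eval : ∀ n, (F n).val → (X n).val → (Y n).val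

/-- The algorithms of a public-key functional encryption scheme with ciphertexts in `C`. -/
structure PKFE (𝓕 : FunClass) (C : ℕ → Wires) where
  pk : ℕ → Wires
  msk : ℕ → Wires
  sk : ℕ → Wires
  setupRand : ℕ → Wires
  kgRand : ℕ → Wires
  encRand : ℕ → Wires
  decRand : ℕ → Wires
  setup : ∀ n, (setupRand n).val → (pk n).val × (msk n).val
  kg : ∀ n, (msk n).val → (𝓕.F n).val → (kgRand n).val → (sk n).val
  enc : ∀ n, (pk n).val → (𝓕.X n).val → (encRand n).val → (C n).val
  dec : ∀ n, (sk n).val → (C n).val → (decRand n).val → Option (𝓕.Y n).val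

/-- All algorithms of the scheme are PPT. -/
structure PKFE.IsEfficient {𝓕 : FunClass} {C : ℕ → Wires} (S : PKFE 𝓕 C) : Prop where
  setup : IsPPT (a := fun _ => Wires.unit) (b := fun n => S.pk n ⊠ S.msk n)
    fun n _ r => S.setup n r
  kg : IsPPT (a := fun n => S.msk n ⊠ 𝓕.F n) fun n x r => S.kg n x.1 x.2 r
  enc : IsPPT (a := fun n => S.pk n ⊠ 𝓕.X n) fun n x r => S.enc n x.1 x.2 r
  dec : ∃ d : ∀ n, (S.sk n ⊠ C n).val → (S.decRand n).val → (Wires.bit ⊠ 𝓕.Y n).val,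
    IsPPT d ∧ ∀ n k c r, S.dec n k c r = toOption (d n (k, c) r)

/-- The algorithms of a single-decryptor encryption scheme with messages in `M`. The quantum key
generation outputs a density matrix on the register `dk`. Decryption of a ciphertext is the
measurement (POVM) on `dk` with outcomes in `{⊥} ∪ M`. -/
structure SDE (M : ℕ → Wires) where
  pk : ℕ → Wires
  sk : ℕ → Wires
  dk : ℕ → Wires
  ct : ℕ → Wires
  setupRand : ℕ → Wires
  encRand : ℕ → Wires
  setup : ∀ n, (setupRand n).val → (pk n).val × (sk n).val
  qkg : ∀ n, (sk n).val → Op (dk n)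
  enc : ∀ n, (pk n).val → (M n).val → (encRand n).val → (ct n).val
  dec : ∀ n, (ct n).val → Option (M n).val → Op (dk n)

/-- Setup and encryption are PPT, key generation and decryption are QPT. -/
structure SDE.IsEfficient {M : ℕ → Wires} (S : SDE M) : Prop where
  setup : IsPPT (a := fun _ => Wires.unit) (b := fun n => S.pk n ⊠ S.sk n)
    fun n _ r => S.setup n r
  qkg : ∃ Q : ∀ n, QCirc (S.sk n) (S.dk n), IsQPT Q ∧ ∀ n k, (Q n).denote (ket k) = S.qkg n k
  enc : IsPPT (a := fun n => S.pk n ⊠ M n) fun n x r => S.enc n x.1 x.2 r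
  dec : ∃ Q : ∀ n, QCirc (S.ct n ⊠ S.dk n) (Wires.bit ⊠ M n), IsQPT Q ∧
    ∀ n c (m : Option (M n).val), S.dec n c m = Matrix.of fun i j =>
      ∑ x, if toOption x = m then (Q n).denote (Matrix.single (c, j) (c, i) 1) x x else 0

/-- The algorithms of a single-decryptor functional encryption scheme; the conventions are those
of `SDE`. -/
structure SDFE (𝓕 : FunClass) where
  pk : ℕ → Wires
  msk : ℕ → Wires
  sk : ℕ → Wires
  ct : ℕ → Wires
  setupRand : ℕ → Wires
  encRand : ℕ → Wires
  setup : ∀ n, (setupRand n).val → (pk n).val × (msk n).val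
  qkg : ∀ n, (msk n).val → (𝓕.F n).val → Op (sk n)
  enc : ∀ n, (pk n).val → (𝓕.X n).val → (encRand n).val → (ct n).val
  dec : ∀ n, (ct n).val → Option (𝓕.Y n).val → Op (sk n)

/-- The nested scheme: a PKFE ciphertext is encrypted under SDE. -/
def nested {𝓕 : FunClass} {C : ℕ → Wires} (fe : PKFE 𝓕 C) (sde : SDE C) : SDFE 𝓕 where
  pk n := fe.pk n ⊠ sde.pk n
  msk n := fe.msk n ⊠ sde.sk n
  sk n := fe.sk n ⊠ sde.dk n
  ct n := sde.ct n
  setupRand n := fe.setupRand n ⊠ sde.setupRand n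
  encRand n := fe.encRand n ⊠ sde.encRand n
  setup n r :=
    (((fe.setup n r.1).1, (sde.setup n r.2).1), ((fe.setup n r.1).2, (sde.setup n r.2).2))
  qkg n msk f :=
    (Fintype.card (fe.kgRand n).val : ℂ)⁻¹ •
      ∑ r, (ket (fe.kg n msk.1 f r) ⊗ₖ sde.qkg n msk.2 : Op (fe.sk n ⊠ sde.dk n))
  enc n pk x r := sde.enc n pk.2 (fe.enc n pk.1 x r.1) r.2
  dec n ct y :=
    ∑ k, ∑ m : Option (C n).val,
      ((Fintype.card (fe.decRand n).val : ℂ)⁻¹ *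
          ∑ r, if (m.bind fun c => fe.dec n k c r) = y then (1 : ℂ) else 0) •
        (ket k ⊗ₖ sde.dec n ct m : Op (fe.sk n ⊠ sde.dk n))

/-! ## Strong anti-piracy security of SDE for randomized messages -/

/-- A family `𝒢` of randomized functions `g(· ; ·)` with values in `M`. The functions of `𝒢ₙ` are
described by the strings in `keys n`. -/
structure RandFamily (M : ℕ → Wires) where
  key : ℕ → Wires
  dom : ℕ → Wires
  rand : ℕ → Wires
  keys : ∀ n, Set (key n).val
  inputs : ∀ n, Set (dom n).val
  eval : ∀ n, (key n).val → (dom n).val → (rand n).val → (M n).val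

/-- The family `{PKFE.Enc(fe.pk, · ; ·)}`, `fe.pk` in the support of the setup algorithm. -/
def PKFE.encFamily {𝓕 : FunClass} {C : ℕ → Wires} (fe : PKFE 𝓕 C) : RandFamily C where
  key := fe.pk
  dom := 𝓕.X
  rand := fe.encRand
  keys n := {pk | ∃ r, (fe.setup n r).1 = pk}
  inputs := 𝓕.plaintexts
  eval := fe.enc

/-- The distribution of `(coin, Enc(pk, g(m_coin; r)))`, with explicit randomness. -/
def SDE.challenge {M : ℕ → Wires} (S : SDE M) (g : RandFamily M) (n : ℕ) (pk : (S.pk n).val)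
    (k : (g.key n).val) (m₀ m₁ : (g.dom n).val)
    (ω : Bool × (g.rand n).val × (S.encRand n).val) : Bool × (S.ct n).val :=
  (ω.1, S.enc n pk (g.eval n k (if ω.1 then m₁ else m₀) ω.2.1) ω.2.2)

/-- An adversary: given `(pk, dk)` it outputs `(m₀, m₁)`, (the description of) `g`, descriptions
of the circuits of two decryptors, and a joint state of their registers `R₁`, `R₂`. -/
structure SDEPirate {M : ℕ → Wires} (S : SDE M) (g : RandFamily M) where
  d₁ : ℕ → Wires
  d₂ : ℕ → Wires
  R₁ : ℕ → Wires
  R₂ : ℕ → Wires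
  run : ∀ n, QCirc (S.pk n ⊠ S.dk n)
    ((g.dom n ⊠ g.dom n ⊠ g.key n ⊠ d₁ n ⊠ d₂ n) ⊠ (R₁ n ⊠ R₂ n))

open Classical in
/-- The probability that the adversary wins the strong `γ`-anti-piracy game with randomized
function family `g`. -/
def SDEPirate.winProb {M : ℕ → Wires} {S : SDE M} {g : RandFamily M} (A : SDEPirate S g)
    (n : ℕ) (γ : ℝ) : ℝ :=
  avg fun r : (S.setupRand n).val =>
    let pk := (S.setup n r).1
    let ρ := (A.run n).denote (ket pk ⊗ₖ S.qkg n (S.setup n r).2)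
    ∑ o : (g.dom n ⊠ g.dom n ⊠ g.key n ⊠ A.d₁ n ⊠ A.d₂ n).val,
      match o with
      | (m₀, m₁, k, s₁, s₂) =>
        if m₀ ∈ g.inputs n ∧ m₁ ∈ g.inputs n ∧ k ∈ g.keys n then
          bothPass
            (testProj (A.R₁ n) γ (S.challenge g n pk k m₀ m₁) ((A.d₁ n).toBits s₁))
            (testProj (A.R₂ n) γ (S.challenge g n pk k m₀ m₁) ((A.d₂ n).toBits s₂))
            (condOn ρ (m₀, m₁, k, s₁, s₂))
        else 0

/-- Strong `γ`-anti-piracy security with randomized function family `g`. -/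
def SDE.StrongAntiPiracyRand {M : ℕ → Wires} (S : SDE M) (g : RandFamily M) (γ : ℕ → ℝ) : Prop :=
  ∀ A : SDEPirate S g, IsQPT A.run → Negligible fun n => A.winProb n (γ n)

/-! ## Challenge-only strong anti-piracy security of SDFE -/

/-- The distribution of `(coin, Enc(pk, x_coin))`, with explicit randomness. -/
def SDFE.challenge {𝓕 : FunClass} (S : SDFE 𝓕) (n : ℕ) (pk : (S.pk n).val)
    (x₀ x₁ : (𝓕.X n).val) (ω : Bool × (S.encRand n).val) : Bool × (S.ct n).val :=
  (ω.1, S.enc n pk (if ω.1 then x₁ else x₀) ω.2)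

/-- A challenge-only adversary: given `pk` it outputs the challenge query `f*` and keeps a quantum
state; given the functional key for `f*` as well, it outputs `(x₀, x₁)`, descriptions of the
circuits of two decryptors, and a joint state of their registers `R₁`, `R₂`. -/
structure SDFEPirate {𝓕 : FunClass} (S : SDFE 𝓕) where
  st : ℕ → Wires
  d₁ : ℕ → Wires
  d₂ : ℕ → Wires
  R₁ : ℕ → Wires
  R₂ : ℕ → Wires
  query : ∀ n, QCirc (S.pk n) (𝓕.F n ⊠ st n)
  run : ∀ n, QCirc (st n ⊠ S.sk n) ((𝓕.X n ⊠ 𝓕.X n ⊠ d₁ n ⊠ d₂ n) ⊠ (R₁ n ⊠ R₂ n))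

open Classical in
/-- The probability that the adversary wins the challenge-only strong `γ`-anti-piracy game. -/
def SDFEPirate.winProb {𝓕 : FunClass} {S : SDFE 𝓕} (A : SDFEPirate S) (n : ℕ) (γ : ℝ) : ℝ :=
  avg fun r : (S.setupRand n).val =>
    let pk := (S.setup n r).1
    let ρ := (A.query n).denote (ket pk)
    ∑ f : (𝓕.F n).val,
      let ρ' := (A.run n).denote (condOn ρ f ⊗ₖ S.qkg n (S.setup n r).2 f)
      ∑ o : (𝓕.X n ⊠ 𝓕.X n ⊠ A.d₁ n ⊠ A.d₂ n).val,
        match o with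
        | (x₀, x₁, s₁, s₂) =>
          if f ∈ 𝓕.functions n ∧ x₀ ∈ 𝓕.plaintexts n ∧ x₁ ∈ 𝓕.plaintexts n ∧
              𝓕.eval n f x₀ ≠ 𝓕.eval n f x₁ then
            bothPass
              (testProj (A.R₁ n) γ (S.challenge n pk x₀ x₁) ((A.d₁ n).toBits s₁))
              (testProj (A.R₂ n) γ (S.challenge n pk x₀ x₁) ((A.d₂ n).toBits s₂))
              (condOn ρ' (x₀, x₁, s₁, s₂))
          else 0

/-- Challenge-only strong `γ`-anti-piracy security. -/
def SDFE.ChallengeOnlyStrongAntiPiracy {𝓕 : FunClass} (S : SDFE 𝓕) (γ : ℕ → ℝ) : Prop :=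
  ∀ A : SDFEPirate S, IsQPT A.query → IsQPT A.run → Negligible fun n => A.winProb n (γ n)

end QCrypto

end

/-! A nested ciphertext of `x` is an SDE encryption of `PKFE.Enc(fe.pk, x; r)`. Hence the challenge
distribution of the functional game for `x₀, x₁` is exactly that of the SDE game for the same inputs
and `g = PKFE.Enc(fe.pk, · ; ·)`. The key for the single query consists of a classical PKFE key and
one copy of `dk`. An SDE adversary that holds `dk` can therefore sample the PKFE keys itself, answer
the query, forward the decryptors of the pirate, and name its own `fe.pk` as `g`; this `fe.pk` lies
in the support of the setup. No security of PKFE is needed.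

With the same keys, query and final state, each win of the pirate is a win of the reduction: the
admissibility conditions of the SDE game are weaker, and a lower threshold only enlarges the
accepting projection. So the winning probability at `γ` is at most that of the reduction at `γ'`
(`winProb_nonneg_and_le_winProb_reductionPirate`).

Two things need work. The circuit `reduction` must produce exactly this state, which is computed on
product states in `denote_reduction`; positivity of all states and tests, which justifies termwise
comparison, comes from the Kraus form of circuits (`QCirc.isCP`). The reduction must also be QPT in
the uniform sense. The code of a composite circuit is a constant tag followed by the codes of its
parts, so it suffices that polynomial-time computable strings are closed under concatenation. This
is shown with explicit stack machines (`PolyTime.append`). -/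

noncomputable section

namespace QCrypto

/-! ## Polynomial-time computable strings -/

section StackMachines

open Turing Turing.TM2 Turing.TM2.Stmt Function

/-- `d` is reached from `c` in exactly `n` steps. -/
inductive Steps {K Λ σ : Type} {Γ : K → Type} [DecidableEq K] (M : Λ → Stmt Γ Λ σ) :
    ℕ → Cfg Γ Λ σ → Cfg Γ Λ σ → Prop
  | refl (c) : Steps M 0 c c
  | head {l v S n d} (h : Steps M n (stepAux (M l) v S) d) : Steps M (n + 1) ⟨some l, v, S⟩ d

theorem Steps.iff_iterate {K Λ σ : Type} {Γ : K → Type} [DecidableEq K] {M : Λ → Stmt Γ Λ σ}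
    {n : ℕ} {c d : Cfg Γ Λ σ} :
    Steps M n c d ↔ (flip bind (TM2.step M))^[n] (some c) = some d := by
  have hnone : ∀ n, (flip bind (TM2.step M))^[n] none = none := by
    intro n
    induction n with
    | zero => rfl
    | succ n ih => rw [iterate_succ_apply]; exact ih
  constructor
  · intro h
    induction h with
    | refl c => rfl
    | head h ih => rw [iterate_succ_apply]; exact ih
  · intro h
    induction n generalizing c with
    | zero => obtain rfl := Option.some.inj h; exact .refl _
    | succ n ih =>
      rw [iterate_succ_apply] at h
      obtain ⟨_ | l, v, S⟩ := c
      · have h' : (flip bind (TM2.step M))^[n] none = some d := h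
        rw [hnone] at h'
        cases h'
      · exact .head (ih h)

theorem Steps.trans {K Λ σ : Type} {Γ : K → Type} [DecidableEq K] {M : Λ → Stmt Γ Λ σ}
    {m n : ℕ} {c d e : Cfg Γ Λ σ} (h : Steps M m c d) (h' : Steps M n d e) :
    Steps M (m + n) c e := by
  induction h with
  | refl c => simpa using h'
  | head h ih => rw [Nat.add_right_comm]; exact .head (ih h')

theorem Steps.of_halted {K Λ σ : Type} {Γ : K → Type} [DecidableEq K] {M : Λ → Stmt Γ Λ σ}
    {n : ℕ} {c d : Cfg Γ Λ σ} (h : Steps M n c d) (hc : c.l = none) : n = 0 ∧ c = d := by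
  cases h with
  | refl => exact ⟨rfl, rfl⟩
  | head h => cases hc

/-! ### Growth of the stacks -/

/-- The number of push instructions of a statement. -/
def pushes {K Λ σ : Type} {Γ : K → Type} : Stmt Γ Λ σ → ℕ
  | push _ _ q => pushes q + 1
  | peek _ _ q => pushes q
  | pop _ _ q => pushes q
  | load _ q => pushes q
  | branch _ q₁ q₂ => pushes q₁ + pushes q₂
  | goto _ => 0
  | halt => 0

theorem length_stepAux_le {K Λ σ : Type} {Γ : K → Type} [DecidableEq K] (k : K)
    (q : Stmt Γ Λ σ) (v : σ) (S : ∀ k, List (Γ k)) :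
    ((stepAux q v S).stk k).length ≤ (S k).length + pushes q := by
  induction q generalizing v S with
  | push j f q ih =>
    refine (ih _ _).trans ?_
    rw [pushes]
    rcases eq_or_ne k j with rfl | h
    · rw [update_self, List.length_cons]; omega
    · rw [update_of_ne h]; omega
  | peek j f q ih => exact ih _ _
  | pop j f q ih =>
    refine (ih _ _).trans ?_
    rcases eq_or_ne k j with rfl | h
    · simp [pushes]
    · simp [pushes, h]
  | load f q ih => exact ih _ _
  | branch f q₁ q₂ ih₁ ih₂ =>
    rw [stepAux, pushes]
    cases f v
    · exact (ih₂ _ _).trans (by omega)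
    · exact (ih₁ _ _).trans (by omega)
  | goto f => simp [pushes]
  | halt => simp [pushes]

/-- Each step executes one statement, which pushes at most `N` symbols. This bounds the output of a
machine by its running time, and so bounds the time needed to move that output to another stack. -/
theorem Steps.length_le {K Λ σ : Type} {Γ : K → Type} [DecidableEq K] {M : Λ → Stmt Γ Λ σ}
    {n : ℕ} {c d : Cfg Γ Λ σ} (h : Steps M n c d) {N : ℕ} (hN : ∀ l, pushes (M l) ≤ N) (k : K) :
    (d.stk k).length ≤ (c.stk k).length + n * N := by
  induction h with
  | refl c => simp
  | @head l v S n d h ih =>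
    have h₁ := length_stepAux_le k (M l) v S
    have h₂ := hN l
    rw [Nat.succ_mul]
    change _ ≤ (S k).length + _
    omega

/-! ### Embedding one machine into another -/

/-- Run a statement on the stacks in the image of `ι`, with the states and labels embedded into
larger sets and `halt` replaced by `fin`. -/
def embed {K K' Λ Λ' σ σ' : Type} (ι : K → K') (Γ : K' → Type) (lab : Λ → Λ') (i : σ → σ')
    (r : σ' → σ) (fin : Stmt Γ Λ' σ') : Stmt (fun k => Γ (ι k)) Λ σ → Stmt Γ Λ' σ'
  | push k f q => push (ι k) (fun s => f (r s)) (embed ι Γ lab i r fin q)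
  | peek k f q => peek (ι k) (fun s x => i (f (r s) x)) (embed ι Γ lab i r fin q)
  | pop k f q => pop (ι k) (fun s x => i (f (r s) x)) (embed ι Γ lab i r fin q)
  | load f q => load (fun s => i (f (r s))) (embed ι Γ lab i r fin q)
  | branch f q₁ q₂ =>
      branch (fun s => f (r s)) (embed ι Γ lab i r fin q₁) (embed ι Γ lab i r fin q₂)
  | goto f => goto fun s => lab (f (r s))
  | halt => fin

section Embed

variable {K K' Λ Λ' σ σ' : Type} [DecidableEq K] [DecidableEq K'] {ι : K → K'} {Γ : K' → Type}
  {lab : Λ → Λ'} {i : σ → σ'} {r : σ' → σ} {fin : Stmt Γ Λ' σ'}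

/-- By induction on the statement: since `r` is a retraction of `i`, the embedded statement reads
the original state, and since `ι` is injective, updates on image stacks do not interfere. At `halt`
the statement `fin` runs within the same step. -/
theorem stepAux_embed (hι : Injective ι) (hr : ∀ s, r (i s) = s)
    (q : Stmt (fun k => Γ (ι k)) Λ σ) (v : σ) (S : ∀ k, List (Γ (ι k))) (T : ∀ k, List (Γ k))
    (hT : ∀ k, T (ι k) = S k) :
    ∃ T' : ∀ k, List (Γ k), (∀ k, T' (ι k) = (stepAux q v S).stk k) ∧
      (∀ k, (∀ j, k ≠ ι j) → T' k = T k) ∧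
      stepAux (embed ι Γ lab i r fin q) (i v) T =
        match (stepAux q v S).l with
        | some l => ⟨some (lab l), i (stepAux q v S).var, T'⟩
        | none => stepAux fin (i (stepAux q v S).var) T' := by
  have hupd : ∀ (S : ∀ k, List (Γ (ι k))) (T : ∀ k, List (Γ k)) (_ : ∀ k, T (ι k) = S k)
      (k : K) (x : List (Γ (ι k))) (j : K), update T (ι k) x (ι j) = update S k x j := by
    intro S T hT k x j
    rcases eq_or_ne j k with rfl | h
    · simp
    · rw [update_of_ne (fun e => h (hι e)), update_of_ne h, hT]
  induction q generalizing v S T with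
  | push k f q ih =>
    obtain ⟨T', h₁, h₂, h₃⟩ := ih v (update S k (f v :: S k)) (update T (ι k) (f v :: T (ι k)))
      (by rw [hT]; exact hupd S T hT k _)
    refine ⟨T', h₁, fun j hj => (h₂ j hj).trans (update_of_ne (hj k) _ _), ?_⟩
    rw [embed, stepAux, stepAux, hr]
    exact h₃
  | peek k f q ih =>
    obtain ⟨T', h₁, h₂, h₃⟩ := ih (f v (S k).head?) S T hT
    refine ⟨T', h₁, h₂, ?_⟩
    rw [embed, stepAux, stepAux, hr, hT]
    exact h₃
  | pop k f q ih =>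
    obtain ⟨T', h₁, h₂, h₃⟩ := ih (f v (S k).head?) (update S k (S k).tail)
      (update T (ι k) (T (ι k)).tail) (by rw [hT]; exact hupd S T hT k _)
    refine ⟨T', h₁, fun j hj => (h₂ j hj).trans (update_of_ne (hj k) _ _), ?_⟩
    rw [embed, stepAux, stepAux, hr]
    rw [← hT] at h₃ ⊢
    exact h₃
  | load f q ih =>
    obtain ⟨T', h₁, h₂, h₃⟩ := ih (f v) S T hT
    refine ⟨T', h₁, h₂, ?_⟩
    rw [embed, stepAux, stepAux, hr]
    exact h₃
  | branch f q₁ q₂ ih₁ ih₂ =>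
    rw [embed, stepAux, stepAux, hr]
    cases f v
    · exact ih₂ v S T hT
    · exact ih₁ v S T hT
  | goto f => exact ⟨T, hT, fun _ _ => rfl, by simp [embed, hr]⟩
  | halt => exact ⟨T, hT, fun _ _ => rfl, by simp [embed]⟩

/-- Stated in continuation form so that phases of a program can be chained. The count is `n + m`
without overhead because `fin` belongs to the last of the `n` steps. -/
theorem Steps.embed (hι : Injective ι) (hr : ∀ s, r (i s) = s)
    {M : Λ → Stmt (fun k => Γ (ι k)) Λ σ} {M' : Λ' → Stmt Γ Λ' σ'}
    (hM : ∀ l, M' (lab l) = embed ι Γ lab i r fin (M l))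
    {n : ℕ} {c d : Cfg (fun k => Γ (ι k)) Λ σ} (h : Steps M n c d) (hd : d.l = none) {l : Λ}
    (hl : c.l = some l) (T : ∀ k, List (Γ k)) (hT : ∀ k, T (ι k) = c.stk k) :
    ∃ T' : ∀ k, List (Γ k), (∀ k, T' (ι k) = d.stk k) ∧ (∀ k, (∀ j, k ≠ ι j) → T' k = T k) ∧
      ∀ m e, Steps M' m (stepAux fin (i d.var) T') e →
        Steps M' (n + m) ⟨some (lab l), i c.var, T⟩ e := by
  induction h generalizing l T with
  | refl c => rw [hd] at hl; cases hl
  | @head l' v S n d h ih =>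
    obtain rfl : l' = l := Option.some.inj hl
    obtain ⟨T₁, h₁, h₂, h₃⟩ := stepAux_embed (fin := fin) (lab := lab) (i := i) (r := r) hι hr
      (M l') v S T hT
    rw [← hM] at h₃
    cases hx : (stepAux (M l') v S).l with
    | some l₁ =>
      obtain ⟨T₂, g₁, g₂, g₃⟩ := ih hd hx T₁ h₁
      refine ⟨T₂, g₁, fun k hk => (g₂ k hk).trans (h₂ k hk), fun m e he => ?_⟩
      rw [Nat.add_right_comm]
      refine .head ?_
      rw [hx] at h₃
      exact h₃ ▸ g₃ m e he
    | none =>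
      rw [hx] at h₃
      obtain ⟨rfl, rfl⟩ := h.of_halted hx
      refine ⟨T₁, h₁, h₂, fun m e he => ?_⟩
      rw [zero_add, add_comm]
      exact .head (h₃ ▸ he)

end Embed

/-! ### Polynomial-time families and their runs -/

/-- A family of bit strings that is computed in polynomial time from `1ⁿ`. -/
def PolyTime (f : ℕ → List Bool) : Prop :=
  Nonempty (TM2ComputableInPolyTime Computability.unaryEncodeNat (fun l : List Bool => l) f)

/-- Stack contents that are empty except on one stack. -/
def only {K : Type} [DecidableEq K] {Γ : K → Type} (k : K) (s : List (Γ k)) : ∀ k, List (Γ k) :=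
  update (fun _ => []) k s

theorem update_only {K : Type} [DecidableEq K] {Γ : K → Type} (k : K) (s t : List (Γ k)) :
    update (only k s) k t = only k t :=
  update_idem _ _ _

theorem only_self {K : Type} [DecidableEq K] {Γ : K → Type} (k : K) (s : List (Γ k)) :
    only k s k = s :=
  update_self _ _ _

theorem only_nil {K : Type} [DecidableEq K] {Γ : K → Type} (k : K) :
    only (Γ := Γ) k [] = fun _ => [] :=
  update_eq_self _ _

theorem dite_eq_only {K : Type} [DecidableEq K] {Γ : K → Type} (k₀ : K) (s : List (Γ k₀)) :
    (fun k => if h : k = k₀ then by rw [h]; exact s else []) = only k₀ s := by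
  funext k
  rcases eq_or_ne k k₀ with rfl | h
  · simp [only_self]
  · simp [only, h]

theorem unaryEncodeNat_eq_replicate (n : ℕ) :
    Computability.unaryEncodeNat n = List.replicate n true := by
  induction n with
  | zero => rfl
  | succ n ih => rw [Computability.unaryEncodeNat, ih, List.replicate_succ]

/-- A valid output requires the initial internal state and empty stacks apart from the output stack,
so every machine built below has to clean up after itself. -/
theorem nonempty_outputsInTime_iff {tm : FinTM2} {s : List (tm.Γ tm.k₀)}
    {s' : List (tm.Γ tm.k₁)} {t : ℕ} :
    Nonempty (TM2OutputsInTime tm s (some s') t) ↔ ∃ m ≤ t, Steps tm.m m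
      ⟨some tm.main, tm.initialState, only tm.k₀ s⟩ ⟨none, tm.initialState, only tm.k₁ s'⟩ := by
  rw [← dite_eq_only, ← dite_eq_only]
  constructor
  · rintro ⟨⟨⟨m, e⟩, hm⟩⟩
    exact ⟨m, hm, Steps.iff_iterate.2 e⟩
  · rintro ⟨m, hm, hs⟩
    exact ⟨⟨⟨m, Steps.iff_iterate.1 hs⟩, hm⟩⟩

theorem TM2ComputableInPolyTime.steps {f : ℕ → List Bool}
    (h : TM2ComputableInPolyTime Computability.unaryEncodeNat (fun l : List Bool => l) f) (n : ℕ) :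
    ∃ m ≤ h.time.eval n, Steps h.tm.m m
      ⟨some h.tm.main, h.tm.initialState,
        only h.tm.k₀ (List.replicate n (h.inputAlphabet.symm true))⟩
      ⟨none, h.tm.initialState, only h.tm.k₁ ((f n).map h.outputAlphabet.symm)⟩ := by
  have e := nonempty_outputsInTime_iff.1 ⟨h.outputsFun n⟩
  rw [unaryEncodeNat_eq_replicate, List.length_replicate, List.map_replicate] at e
  exact e

theorem PolyTime.of_steps {f : ℕ → List Bool} (tm : FinTM2) (ein : tm.Γ tm.k₀ ≃ Bool)
    (eout : tm.Γ tm.k₁ ≃ Bool) (p : Polynomial ℕ)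
    (h : ∀ n, ∃ m ≤ p.eval n, Steps tm.m m
      ⟨some tm.main, tm.initialState, only tm.k₀ (List.replicate n (ein.symm true))⟩
      ⟨none, tm.initialState, only tm.k₁ ((f n).map eout.symm)⟩) : PolyTime f := by
  refine ⟨⟨⟨tm, ein, eout⟩, p, fun n => Nonempty.some ?_⟩⟩
  rw [unaryEncodeNat_eq_replicate, List.length_replicate, List.map_replicate]
  exact nonempty_outputsInTime_iff.2 (h n)

/-! ### The empty string -/

/-- A machine that erases its input. -/
def eraser : FinTM2 where
  K := Unit
  k₀ := ()
  k₁ := ()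
  Γ _ := Bool
  Λ := Unit
  main := ()
  σ := Bool
  initialState := false
  m _ := pop () (fun _ x => x.isSome) (branch id (goto fun _ => ()) halt)

/-- The extra step is the pop on the empty stack; it detects the end and resets the state to
`false`, the initial state. -/
theorem eraser_steps (n : ℕ) (b : Bool) :
    Steps eraser.m (n + 1) ⟨some (), b, only () (List.replicate n true)⟩
      ⟨none, false, only () []⟩ := by
  induction n generalizing b with
  | zero => exact .head (Steps.refl _)
  | succ n ih =>
    refine .head ?_
    have h : stepAux (eraser.m ()) b (only () (List.replicate (n + 1) true)) =
        ⟨some (), true, only () (List.replicate n true)⟩ := by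
      exact congrArg (TM2.Cfg.mk _ _) (funext fun _ => rfl)
    rw [h]
    exact ih true

theorem PolyTime.nil : PolyTime fun _ => [] :=
  .of_steps eraser (Equiv.refl Bool) (Equiv.refl Bool) (Polynomial.X + 1) fun n =>
    ⟨n + 1, by simp, eraser_steps n false⟩

/-! ### Prepending a bit -/

/-- Run a machine and push a symbol on its output. -/
def consMachine (tm : FinTM2) (x : tm.Γ tm.k₁) : FinTM2 where
  K := tm.K
  kDecidableEq := tm.kDecidableEq
  kFin := tm.kFin
  k₀ := tm.k₀
  k₁ := tm.k₁
  Γ := tm.Γ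
  Λ := tm.Λ
  main := tm.main
  ΛFin := tm.ΛFin
  σ := tm.σ
  initialState := tm.initialState
  σFin := tm.σFin
  Γk₀Fin := tm.Γk₀Fin
  m l := embed id tm.Γ id id id (push tm.k₁ (fun _ => x) halt) (tm.m l)

theorem PolyTime.cons {f : ℕ → List Bool} (hf : PolyTime f) (b : Bool) :
    PolyTime fun n => b :: f n := by
  obtain ⟨h⟩ := hf
  refine .of_steps (consMachine h.tm (h.outputAlphabet.symm b)) h.inputAlphabet h.outputAlphabet
    h.time fun n => ?_
  obtain ⟨m, hm, hs⟩ := TM2ComputableInPolyTime.steps h n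
  refine ⟨m, hm, ?_⟩
  obtain ⟨T, h₁, -, h₃⟩ := hs.embed (ι := id) (Γ := h.tm.Γ) (lab := id) (i := id) (r := id)
    (fin := push h.tm.k₁ (fun _ => h.outputAlphabet.symm b) halt)
    (M' := (consMachine h.tm (h.outputAlphabet.symm b)).m) injective_id (fun _ => rfl)
    (fun _ => rfl) rfl rfl _ (fun _ => rfl)
  obtain rfl : T = only h.tm.k₁ ((f n).map h.outputAlphabet.symm) := funext h₁
  -- The additional push is part of the halting step, so no time is added.
  refine h₃ 0 _ ?_
  rw [stepAux, only_self, update_only]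
  exact .refl _

/-! ### Concatenation -/

section Append

variable (tm₁ tm₂ : FinTM2) (in₁ : tm₁.Γ tm₁.k₀ ≃ Bool) (in₂ : tm₂.Γ tm₂.k₀ ≃ Bool)
  (out₁ : tm₁.Γ tm₁.k₁ ≃ Bool) (out₂ : tm₂.Γ tm₂.k₁ ≃ Bool)

/-- The stack alphabets of two machines, and one more stack of bits. -/
@[reducible] def appendΓ : Option (tm₁.K ⊕ tm₂.K) → Type
  | none => Bool
  | some (.inl k) => tm₁.Γ k
  | some (.inr k) => tm₂.Γ k

abbrev appendσ : Type := tm₁.σ ⊕ (tm₂.σ ⊕ Option Bool)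

abbrev appendΛ : Type := tm₁.Λ ⊕ (tm₂.Λ ⊕ Fin 3)

variable {tm₁ tm₂} in
/-- The stacks of the two machines side by side. -/
def sideBySide (a : List Bool) (S₁ : ∀ k, List (tm₁.Γ k)) (S₂ : ∀ k, List (tm₂.Γ k)) :
    ∀ k, List (appendΓ tm₁ tm₂ k)
  | none => a
  | some (.inl k) => S₁ k
  | some (.inr k) => S₂ k

variable {tm₁ tm₂} in
/-- The content of the bit register of the state. -/
def regOf : appendσ tm₁ tm₂ → Option Bool
  | .inr (.inr b) => b
  | _ => none

abbrev appendStmt : Type := Stmt (appendΓ tm₁ tm₂) (appendΛ tm₁ tm₂) (appendσ tm₁ tm₂)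

/-- Duplicate the input and start the first machine. -/
def copyStmt : appendStmt tm₁ tm₂ :=
  pop none (fun _ x => .inr (.inr x)) <|
    branch (fun s => (regOf s).isSome)
      (push (some (.inl tm₁.k₀)) (fun _ => in₁.symm true) <|
        push (some (.inr tm₂.k₀)) (fun _ => in₂.symm true) <| goto fun _ => .inr (.inr 0))
      (load (fun _ => .inl tm₁.initialState) <| goto fun _ => .inl tm₁.main)

/-- Move the output of the first machine to the additional stack. -/
def unloadStmt : appendStmt tm₁ tm₂ :=
  pop (some (.inl tm₁.k₁)) (fun _ x => .inr (.inr (x.map out₁))) <|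
    branch (fun s => (regOf s).isSome)
      (push none (fun s => (regOf s).getD true) <| goto fun _ => .inr (.inr 1))
      (goto fun _ => .inr (.inr 2))

/-- Move the additional stack to the output of the second machine. -/
def reloadStmt : appendStmt tm₁ tm₂ :=
  pop none (fun _ x => .inr (.inr x)) <|
    branch (fun s => (regOf s).isSome)
      (push (some (.inr tm₂.k₁)) (fun s => out₂.symm ((regOf s).getD true)) <|
        goto fun _ => .inr (.inr 2))
      halt

/-- Run two machines on the same input and concatenate the outputs. -/
def appendProgram : appendΛ tm₁ tm₂ → appendStmt tm₁ tm₂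
  | .inl l => embed (fun k => some (.inl k)) (appendΓ tm₁ tm₂) .inl .inl
      (Sum.elim id fun _ => tm₁.initialState)
      (load (fun _ => .inr (.inl tm₂.initialState)) <| goto fun _ => .inr (.inl tm₂.main))
      (tm₁.m l)
  | .inr (.inl l) => embed (fun k => some (.inr k)) (appendΓ tm₁ tm₂) (fun l => .inr (.inl l))
      (fun s => .inr (.inl s))
      (Sum.elim (fun _ => tm₂.initialState) (Sum.elim id fun _ => tm₂.initialState))
      (load (fun _ => .inr (.inr none)) <| goto fun _ => .inr (.inr 1))
      (tm₂.m l)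
  | .inr (.inr 0) => copyStmt tm₁ tm₂ in₁ in₂
  | .inr (.inr 1) => unloadStmt tm₁ tm₂ out₁
  | .inr (.inr 2) => reloadStmt tm₁ tm₂ out₂

/-- The machine with the program `appendProgram`. -/
def appendMachine : FinTM2 where
  K := Option (tm₁.K ⊕ tm₂.K)
  kFin := letI := tm₁.kFin; letI := tm₂.kFin; inferInstance
  k₀ := none
  k₁ := some (.inr tm₂.k₁)
  Γ := appendΓ tm₁ tm₂
  Λ := appendΛ tm₁ tm₂
  main := .inr (.inr 0)
  ΛFin := letI := tm₁.ΛFin; letI := tm₂.ΛFin; inferInstance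
  σ := appendσ tm₁ tm₂
  initialState := .inr (.inr none)
  σFin := letI := tm₁.σFin; letI := tm₂.σFin; inferInstance
  Γk₀Fin := inferInstanceAs (Fintype Bool)
  m := appendProgram tm₁ tm₂ in₁ in₂ out₁ out₂

variable {tm₁ tm₂} (a : List Bool) (S₁ : ∀ k, List (tm₁.Γ k)) (S₂ : ∀ k, List (tm₂.Γ k))

theorem update_sideBySide_none (b : List Bool) :
    update (sideBySide a S₁ S₂) none b = sideBySide b S₁ S₂ := by
  funext k
  rcases k with _ | k | k
  · exact update_self _ _ _
  · exact update_of_ne (by simp) _ _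
  · exact update_of_ne (by simp) _ _

theorem update_sideBySide_inl (k : tm₁.K) (x : List (tm₁.Γ k)) :
    update (sideBySide a S₁ S₂) (some (.inl k)) x = sideBySide a (update S₁ k x) S₂ := by
  funext j
  rcases j with _ | j | j
  · exact update_of_ne (by simp) _ _
  · rcases eq_or_ne j k with rfl | h
    · exact (update_self _ _ _).trans (update_self (f := S₁) _ _).symm
    · exact (update_of_ne (by simpa using h) _ _).trans (update_of_ne (f := S₁) h _).symm
  · exact update_of_ne (by simp) _ _

theorem update_sideBySide_inr (k : tm₂.K) (x : List (tm₂.Γ k)) :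
    update (sideBySide a S₁ S₂) (some (.inr k)) x = sideBySide a S₁ (update S₂ k x) := by
  funext j
  rcases j with _ | j | j
  · exact update_of_ne (by simp) _ _
  · exact update_of_ne (by simp) _ _
  · rcases eq_or_ne j k with rfl | h
    · exact (update_self _ _ _).trans (update_self (f := S₂) _ _).symm
    · exact (update_of_ne (by simpa using h) _ _).trans (update_of_ne (f := S₂) h _).symm

theorem stepAux_branch_of_true {K Λ σ : Type} {Γ : K → Type} [DecidableEq K] {f : σ → Bool}
    {q₁ q₂ : Stmt Γ Λ σ} {v : σ} {S : ∀ k, List (Γ k)} (h : f v = true) :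
    stepAux (branch f q₁ q₂) v S = stepAux q₁ v S := by
  rw [stepAux, h, cond_true]

/-- The induction needs `j`, the number of symbols already copied. The input is unary, so copying
only has to count. -/
theorem copy_steps (n j : ℕ) (s : appendσ tm₁ tm₂) :
    Steps (appendProgram tm₁ tm₂ in₁ in₂ out₁ out₂) (n + 1)
      ⟨some (.inr (.inr 0)), s, sideBySide (List.replicate n true)
        (only tm₁.k₀ (List.replicate j (in₁.symm true)))
        (only tm₂.k₀ (List.replicate j (in₂.symm true)))⟩
      ⟨some (.inl tm₁.main), .inl tm₁.initialState, sideBySide []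
        (only tm₁.k₀ (List.replicate (n + j) (in₁.symm true)))
        (only tm₂.k₀ (List.replicate (n + j) (in₂.symm true)))⟩ := by
  induction n generalizing j s with
  | zero =>
    rw [zero_add, zero_add]
    have key : stepAux (copyStmt tm₁ tm₂ in₁ in₂) s (sideBySide (List.replicate 0 true)
        (only tm₁.k₀ (List.replicate j (in₁.symm true)))
        (only tm₂.k₀ (List.replicate j (in₂.symm true)))) =
        ⟨some (.inl tm₁.main), .inl tm₁.initialState, sideBySide []
        (only tm₁.k₀ (List.replicate j (in₁.symm true)))
        (only tm₂.k₀ (List.replicate j (in₂.symm true)))⟩ :=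
      congrArg (TM2.Cfg.mk _ _) (update_sideBySide_none _ _ _ _)
    exact .head (key ▸ Steps.refl _)
  | succ n ih =>
    rw [Nat.add_right_comm n 1 j, Nat.add_assoc n j 1]
    have key : stepAux (copyStmt tm₁ tm₂ in₁ in₂) s (sideBySide (List.replicate (n + 1) true)
        (only tm₁.k₀ (List.replicate j (in₁.symm true)))
        (only tm₂.k₀ (List.replicate j (in₂.symm true)))) =
        ⟨some (.inr (.inr 0)), .inr (.inr (some true)), sideBySide (List.replicate n true)
        (only tm₁.k₀ (List.replicate (j + 1) (in₁.symm true)))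
        (only tm₂.k₀ (List.replicate (j + 1) (in₂.symm true)))⟩ := by
      have h₁ : ∀ b, sideBySide b (only tm₁.k₀ (List.replicate j (in₁.symm true)))
          (only tm₂.k₀ (List.replicate j (in₂.symm true))) (some (.inl tm₁.k₀)) =
          List.replicate j (in₁.symm true) := fun b => only_self _ _
      have h₂ : ∀ b S, sideBySide (tm₁ := tm₁) b S
          (only tm₂.k₀ (List.replicate j (in₂.symm true))) (some (.inr tm₂.k₀)) =
          List.replicate j (in₂.symm true) := fun b S => only_self _ _
      rw [copyStmt, stepAux, update_sideBySide_none, stepAux_branch_of_true rfl, stepAux, h₁,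
        update_sideBySide_inl, stepAux, h₂, update_sideBySide_inr, update_only, update_only]
      rfl
    exact .head (key ▸ ih (j + 1) _)

/-- Popping onto the auxiliary stack reverses the string; `reload_steps` reverses it back. The one
extra step is the pop that finds the stack empty. -/
theorem unload_steps (l a : List Bool) (s : appendσ tm₁ tm₂) :
    Steps (appendProgram tm₁ tm₂ in₁ in₂ out₁ out₂) (l.length + 1)
      ⟨some (.inr (.inr 1)), s, sideBySide a (only tm₁.k₁ (l.map out₁.symm)) S₂⟩
      ⟨some (.inr (.inr 2)), .inr (.inr none), sideBySide (l.reverse ++ a) (fun _ => []) S₂⟩ := by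
  induction l generalizing a s with
  | nil =>
    have key : stepAux (unloadStmt tm₁ tm₂ out₁) s
        (sideBySide a (only tm₁.k₁ (List.map out₁.symm [])) S₂) =
        ⟨some (.inr (.inr 2)), .inr (.inr none), sideBySide a (fun _ => []) S₂⟩ := by
      have h : sideBySide a (only tm₁.k₁ (List.map out₁.symm [])) S₂ (some (.inl tm₁.k₁)) =
          [] := only_self _ _
      rw [unloadStmt, stepAux, h, update_sideBySide_inl, update_only, ← only_nil tm₁.k₁]
      rfl
    exact .head (key ▸ Steps.refl _)
  | cons b l ih =>
    rw [List.reverse_cons, List.append_assoc]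
    have key : stepAux (unloadStmt tm₁ tm₂ out₁) s
        (sideBySide a (only tm₁.k₁ (List.map out₁.symm (b :: l))) S₂) =
        ⟨some (.inr (.inr 1)), .inr (.inr (some b)),
          sideBySide (b :: a) (only tm₁.k₁ (List.map out₁.symm l)) S₂⟩ := by
      have h : sideBySide a (only tm₁.k₁ (List.map out₁.symm (b :: l))) S₂
          (some (.inl tm₁.k₁)) = out₁.symm b :: List.map out₁.symm l := only_self _ _
      rw [unloadStmt, stepAux, h, update_sideBySide_inl, update_only, List.head?_cons,
        Option.map_some, Equiv.apply_symm_apply, stepAux_branch_of_true rfl, stepAux,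
        update_sideBySide_none]
      rfl
    exact .head (key ▸ ih (b :: a) _)

theorem reload_steps (l b : List Bool) (s : appendσ tm₁ tm₂) :
    Steps (appendProgram tm₁ tm₂ in₁ in₂ out₁ out₂) (l.length + 1)
      ⟨some (.inr (.inr 2)), s, sideBySide l S₁ (only tm₂.k₁ (b.map out₂.symm))⟩
      ⟨none, .inr (.inr none),
        sideBySide [] S₁ (only tm₂.k₁ ((l.reverse ++ b).map out₂.symm))⟩ := by
  induction l generalizing b s with
  | nil =>
    have key : stepAux (reloadStmt tm₁ tm₂ out₂) s
        (sideBySide [] S₁ (only tm₂.k₁ (b.map out₂.symm))) =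
        ⟨none, .inr (.inr none), sideBySide [] S₁ (only tm₂.k₁ (b.map out₂.symm))⟩ :=
      congrArg (TM2.Cfg.mk _ _) (update_sideBySide_none _ _ _ _)
    exact .head (key ▸ Steps.refl _)
  | cons c l ih =>
    rw [List.reverse_cons, List.append_assoc]
    have key : stepAux (reloadStmt tm₁ tm₂ out₂) s
        (sideBySide (c :: l) S₁ (only tm₂.k₁ (b.map out₂.symm))) =
        ⟨some (.inr (.inr 2)), .inr (.inr (some c)),
          sideBySide l S₁ (only tm₂.k₁ ((c :: b).map out₂.symm))⟩ := by
      have h : ∀ a, sideBySide a S₁ (only tm₂.k₁ (b.map out₂.symm)) (some (.inr tm₂.k₁)) =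
          b.map out₂.symm := fun a => only_self _ _
      rw [reloadStmt, stepAux, update_sideBySide_none, stepAux_branch_of_true rfl, stepAux, h,
        update_sideBySide_inr, update_only]
      rfl
    exact .head (key ▸ ih (c :: b) _)

end Append

/-- One machine duplicates the input, runs both machines on disjoint stacks, and then moves the
first output, through the auxiliary stack, on top of the second. The input stack is empty after the
duplication and serves as the auxiliary stack. -/
theorem PolyTime.append {f g : ℕ → List Bool} (hf : PolyTime f) (hg : PolyTime g) :
    PolyTime fun n => f n ++ g n := by
  obtain ⟨⟨⟨tm₁, in₁, out₁⟩, p₁, o₁⟩⟩ := hf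
  obtain ⟨⟨⟨tm₂, in₂, out₂⟩, p₂, o₂⟩⟩ := hg
  obtain ⟨N, hN⟩ : ∃ N, ∀ l, pushes (tm₁.m l) ≤ N := by
    let := tm₁.ΛFin
    exact ⟨Finset.univ.sup fun l => pushes (tm₁.m l), fun l =>
      Finset.le_sup (f := fun l => pushes (tm₁.m l)) (Finset.mem_univ l)⟩
  -- The summands are the copying, the two runs, and the two moves of the first output. The output
  -- has length at most `n + p₁(n) * N`.
  refine .of_steps (appendMachine tm₁ tm₂ in₁ in₂ out₁ out₂) (Equiv.refl Bool) out₂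
    ((Polynomial.X + 1) + (p₁ + (p₂ + 2 * (Polynomial.X + p₁ * Polynomial.C N + 1)))) fun n => ?_
  obtain ⟨m₁, hm₁, hs₁⟩ := TM2ComputableInPolyTime.steps ⟨⟨tm₁, in₁, out₁⟩, p₁, o₁⟩ n
  obtain ⟨m₂, hm₂, hs₂⟩ := TM2ComputableInPolyTime.steps ⟨⟨tm₂, in₂, out₂⟩, p₂, o₂⟩ n
  have hlen : (f n).length ≤ n + m₁ * N := by
    have := hs₁.length_le hN tm₁.k₁
    simp only [only_self, List.length_map] at this
    refine this.trans (Nat.add_le_add_right ?_ _)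
    simp only [only]
    -- The output stack may coincide with the input stack, in which case it starts with `n` symbols.
    rcases eq_or_ne tm₁.k₁ tm₁.k₀ with h | h
    · rw [h, update_self, List.length_replicate]
    · rw [update_of_ne h]; simp
  dsimp only at hs₁ hs₂ hm₁ hm₂
  obtain ⟨T₁, h₁, h₁', k₁⟩ := hs₁.embed (ι := fun k => some (.inl k)) (Γ := appendΓ tm₁ tm₂)
    (lab := Sum.inl) (i := Sum.inl)
    (r := Sum.elim id fun _ => tm₁.initialState)
    (fin := load (fun _ => .inr (.inl tm₂.initialState)) <| goto fun _ => .inr (.inl tm₂.main))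
    (M' := appendProgram tm₁ tm₂ in₁ in₂ out₁ out₂)
    (fun _ _ h => Sum.inl_injective (Option.some_injective _ h)) (fun _ => rfl)
    (fun _ => rfl) rfl rfl
    (sideBySide [] _ (only tm₂.k₀ (List.replicate n (in₂.symm true)))) (fun _ => rfl)
  obtain rfl : T₁ = sideBySide [] (only tm₁.k₁ ((f n).map out₁.symm))
      (only tm₂.k₀ (List.replicate n (in₂.symm true))) := by
    funext k
    rcases k with _ | k | k
    · exact h₁' _ (by simp)
    · exact h₁ k
    · exact h₁' _ (by simp)
  obtain ⟨T₂, h₂, h₂', k₂⟩ := hs₂.embed (ι := fun k => some (.inr k)) (Γ := appendΓ tm₁ tm₂)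
    (lab := fun l => Sum.inr (.inl l)) (i := fun s => Sum.inr (.inl s))
    (r := Sum.elim (fun _ => tm₂.initialState) (Sum.elim id fun _ => tm₂.initialState))
    (fin := load (fun _ => .inr (.inr none)) <| goto fun _ => .inr (.inr 1))
    (M' := appendProgram tm₁ tm₂ in₁ in₂ out₁ out₂)
    (fun _ _ h => Sum.inr_injective (Option.some_injective _ h)) (fun _ => rfl)
    (fun _ => rfl) rfl rfl
    (sideBySide [] (only tm₁.k₁ ((f n).map out₁.symm)) _) (fun _ => rfl)
  obtain rfl : T₂ = sideBySide [] (only tm₁.k₁ ((f n).map out₁.symm))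
      (only tm₂.k₁ ((g n).map out₂.symm)) := by
    funext k
    rcases k with _ | k | k
    · exact h₂' _ (by simp)
    · exact h₂' _ (by simp)
    · exact h₂ k
  have e₁ := copy_steps in₁ in₂ out₁ out₂ n 0 (.inr (.inr none))
  have e₂ := unload_steps in₁ in₂ out₁ out₂ (only tm₂.k₁ ((g n).map out₂.symm)) (f n) []
    (.inr (.inr none))
  have e₃ := reload_steps in₁ in₂ out₁ out₂ (fun _ => []) (f n).reverse (g n) (.inr (.inr none))
  rw [List.append_nil] at e₂
  rw [List.reverse_reverse] at e₃
  have e := e₁.trans (k₁ _ _ (k₂ _ _ (e₂.trans e₃)))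
  have hstart : sideBySide (tm₁ := tm₁) (tm₂ := tm₂) (List.replicate n true)
      (only tm₁.k₀ (List.replicate 0 (in₁.symm true)))
      (only tm₂.k₀ (List.replicate 0 (in₂.symm true))) =
      only (Γ := appendΓ tm₁ tm₂) none (List.replicate n true) := by
    rw [List.replicate_zero, List.replicate_zero, only_nil, only_nil, only,
      ← update_sideBySide_none []]
    congr 1
    funext k
    rcases k with _ | k | k <;> rfl
  have hend : sideBySide (tm₁ := tm₁) (tm₂ := tm₂) [] (fun _ => [])
      (only tm₂.k₁ ((f n ++ g n).map out₂.symm)) =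
      only (Γ := appendΓ tm₁ tm₂) (some (.inr tm₂.k₁)) ((f n ++ g n).map out₂.symm) := by
    rw [only, only, ← update_sideBySide_inr]
    congr 1
    funext k
    rcases k with _ | k | k <;> rfl
  rw [hstart, hend] at e
  refine ⟨_, ?_, e⟩
  simp only [Polynomial.eval_add, Polynomial.eval_mul, Polynomial.eval_X, Polynomial.eval_one,
    Polynomial.eval_C, Polynomial.eval_ofNat, List.length_reverse]
  have := Nat.mul_le_mul_right N hm₁
  omega

theorem PolyTime.const_append {f : ℕ → List Bool} (hf : PolyTime f) (l : List Bool) :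
    PolyTime fun n => l ++ f n := by
  induction l with
  | nil => exact hf
  | cons b l ih => exact ih.cons b

theorem PolyTime.const (l : List Bool) : PolyTime fun _ => l := by
  simpa using PolyTime.nil.const_append l

end StackMachines

/-! ## Efficient families of circuits -/

section Efficient

/-- A family of circuits of polynomial size with descriptions computable in polynomial time. -/
structure Efficient {a b : ℕ → Wires} (C : ∀ n, QCirc (a n) (b n)) : Prop where
  size_le : ∃ p : Polynomial ℕ, ∀ n, (C n).size ≤ p.eval n
  polyTime : PolyTime fun n => (C n).code

/-- A family of registers of polynomial width. -/
def PolyWidth (a : ℕ → Wires) : Prop := ∃ p : Polynomial ℕ, ∀ n, (a n).width ≤ p.eval n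

variable {a b c d : ℕ → Wires}

theorem PolyWidth.tensor (ha : PolyWidth a) (hb : PolyWidth b) :
    PolyWidth fun n => a n ⊠ b n := by
  obtain ⟨p, hp⟩ := ha
  obtain ⟨q, hq⟩ := hb
  refine ⟨p + q, fun n => ?_⟩
  rw [Polynomial.eval_add]
  exact add_le_add (hp n) (hq n)

theorem PolyWidth.left (h : PolyWidth fun n => a n ⊠ b n) : PolyWidth a :=
  h.imp fun _ hp n => (Nat.le_add_right _ _).trans (hp n)

theorem PolyWidth.right (h : PolyWidth fun n => a n ⊠ b n) : PolyWidth b :=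
  h.imp fun _ hp n => (Nat.le_add_left _ _).trans (hp n)

theorem IsQPT.polyWidth {C : ∀ n, QCirc (a n) (b n)} (h : IsQPT C) : PolyWidth a :=
  h.1.imp fun _ hp n => (Nat.le_add_right _ _).trans (hp n)

theorem IsQPT.efficient {C : ∀ n, QCirc (a n) (b n)} (h : IsQPT C) : Efficient C :=
  ⟨h.1.imp fun _ hp n => (Nat.le_add_left _ _).trans (hp n), h.2⟩

/-- `Efficient` leaves out the width of the input register so that it composes without tracking
intermediate registers; the width is restored only here. -/
theorem Efficient.isQPT {C : ∀ n, QCirc (a n) (b n)} (h : Efficient C) (ha : PolyWidth a) :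
    IsQPT C := by
  obtain ⟨p, hp⟩ := ha
  obtain ⟨q, hq⟩ := h.size_le
  refine ⟨⟨p + q, fun n => ?_⟩, h.polyTime⟩
  rw [Polynomial.eval_add]
  exact add_le_add (hp n) (hq n)

theorem Efficient.seq {C : ∀ n, QCirc (a n) (b n)} {D : ∀ n, QCirc (b n) (c n)}
    (hC : Efficient C) (hD : Efficient D) : Efficient fun n => .seq (C n) (D n) := by
  obtain ⟨p, hp⟩ := hC.size_le
  obtain ⟨q, hq⟩ := hD.size_le
  refine ⟨⟨p + q, fun n => ?_⟩, (hC.polyTime.append hD.polyTime).const_append _⟩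
  rw [Polynomial.eval_add]
  exact add_le_add (hp n) (hq n)

theorem Efficient.par {C : ∀ n, QCirc (a n) (b n)} {D : ∀ n, QCirc (c n) (d n)}
    (hC : Efficient C) (hD : Efficient D) : Efficient fun n => .par (C n) (D n) := by
  obtain ⟨p, hp⟩ := hC.size_le
  obtain ⟨q, hq⟩ := hD.size_le
  refine ⟨⟨p + q, fun n => ?_⟩, (hC.polyTime.append hD.polyTime).const_append _⟩
  rw [Polynomial.eval_add]
  exact add_le_add (hp n) (hq n)

theorem Efficient.id : Efficient fun n => (.id (a n) : QCirc _ _) :=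
  ⟨⟨0, fun _ => Nat.zero_le _⟩, .const _⟩

theorem Efficient.swap : Efficient fun n => (.swap (a n) (b n) : QCirc _ _) :=
  ⟨⟨0, fun _ => Nat.zero_le _⟩, .const _⟩

theorem Efficient.assoc : Efficient fun n => (.assoc (a n) (b n) (c n) : QCirc _ _) :=
  ⟨⟨0, fun _ => Nat.zero_le _⟩, .const _⟩

theorem Efficient.assocInv : Efficient fun n => (.assocInv (a n) (b n) (c n) : QCirc _ _) :=
  ⟨⟨0, fun _ => Nat.zero_le _⟩, .const _⟩

theorem Efficient.unitLInv : Efficient fun n => (.unitLInv (a n) : QCirc _ _) :=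
  ⟨⟨0, fun _ => Nat.zero_le _⟩, .const _⟩

/-- Measure a register and copy the outcome. -/
def dup (a : Wires) : QCirc a (a ⊠ a) := .gate (.classical (.gate (.dup a)))

theorem Efficient.dup (ha : PolyWidth a) : Efficient fun n => QCrypto.dup (a n) := by
  obtain ⟨p, hp⟩ := ha
  -- One width pays for the measurement, the other for the copying. The code concatenates the tags
  -- of the quantum gate, `classical`, the Boolean gate and `dup`; it does not depend on the
  -- register.
  refine ⟨⟨p + p, fun n => ?_⟩,
    .const [true, false, false, false, true, false, false, true, false, false, false, true, false]⟩
  rw [Polynomial.eval_add]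
  exact add_le_add (hp n) (hp n)

/-- Exchange the first two of three registers. -/
def exch (a b c : Wires) : QCirc (a ⊠ b ⊠ c) (b ⊠ a ⊠ c) :=
  .seq (.assocInv a b c) (.seq (.par (.swap a b) (.id c)) (.assoc b a c))

theorem Efficient.exch : Efficient fun n => QCrypto.exch (a n) (b n) (c n) :=
  assocInv.seq ((swap.par id).seq assoc)

end Efficient

/-! ## Quantum operations in Kraus form -/

open Matrix
open scoped ComplexOrder

/-- A completely positive map, given by Kraus operators. -/
def IsCP {α β : Type} [Fintype α] (Φ : Matrix α α ℂ → Matrix β β ℂ) : Prop :=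
  ∃ (ι : Type) (_ : Fintype ι) (K : ι → Matrix β α ℂ), ∀ ρ, Φ ρ = ∑ i, K i * ρ * (K i)ᴴ

section CP

variable {α β γ κ : Type} [Fintype α]
  {Φ : Matrix α α ℂ → Matrix β β ℂ}

theorem IsCP.conj (K : Matrix β α ℂ) : IsCP fun ρ : Matrix α α ℂ => K * ρ * Kᴴ :=
  ⟨Unit, inferInstance, fun _ => K, fun ρ => by simp⟩

theorem IsCP.submatrix [DecidableEq α] (e : β → α) :
    IsCP fun ρ : Matrix α α ℂ => ρ.submatrix e e := by
  refine ⟨Unit, inferInstance, fun _ => (1 : Matrix α α ℂ).submatrix e id, fun ρ => ?_⟩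
  ext i j
  simp [Matrix.mul_apply, Matrix.one_apply]

theorem IsCP.comp [Fintype β] {Ψ : Matrix β β ℂ → Matrix γ γ ℂ} (hΨ : IsCP Ψ) (hΦ : IsCP Φ) :
    IsCP fun ρ => Ψ (Φ ρ) := by
  obtain ⟨ι, _, K, hK⟩ := hΦ
  obtain ⟨ι', _, K', hK'⟩ := hΨ
  refine ⟨ι' × ι, inferInstance, fun i => K' i.1 * K i.2, fun ρ => ?_⟩
  simp only [hK, hK', Fintype.sum_prod_type, Matrix.conjTranspose_mul, Matrix.mul_assoc,
    Matrix.mul_sum, Matrix.sum_mul]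

theorem IsCP.onLeft [Fintype κ] [DecidableEq κ] (hΦ : IsCP Φ) :
    IsCP (onLeft Φ : Matrix (α × κ) (α × κ) ℂ → Matrix (β × κ) (β × κ) ℂ) := by
  obtain ⟨ι, _, K, hK⟩ := hΦ
  refine ⟨ι, inferInstance, fun i => K i ⊗ₖ (1 : Matrix κ κ ℂ), fun ρ => ?_⟩
  ext ⟨p, k⟩ ⟨q, l⟩
  simp only [QCrypto.onLeft, hK, Matrix.of_apply, Matrix.sum_apply]
  refine Finset.sum_congr rfl fun i _ => ?_
  simp [Matrix.mul_apply, Fintype.sum_prod_type, Matrix.one_apply, apply_ite]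

theorem IsCP.onRight [Fintype β] [Fintype κ] [DecidableEq κ] [DecidableEq α] [DecidableEq β]
    (hΦ : IsCP Φ) :
    IsCP (onRight Φ : Matrix (κ × α) (κ × α) ℂ → Matrix (κ × β) (κ × β) ℂ) :=
  (IsCP.submatrix Prod.swap).comp ((hΦ.onLeft (κ := κ)).comp (IsCP.submatrix Prod.swap))

/-- Linearity lets circuits be evaluated on sums of product states, which is how every circuit below
is computed. -/
theorem IsCP.isLinearMap (hΦ : IsCP Φ) : IsLinearMap ℂ Φ := by
  obtain ⟨ι, _, K, hK⟩ := hΦ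
  constructor
  · intro x y
    simp [hK, Matrix.mul_add, Matrix.add_mul, Finset.sum_add_distrib]
  · intro c x
    simp [hK, Finset.smul_sum]

theorem IsCP.map_smul (hΦ : IsCP Φ) (c : ℂ) (ρ : Matrix α α ℂ) : Φ (c • ρ) = c • Φ ρ :=
  hΦ.isLinearMap.map_smul c ρ

theorem IsCP.map_zero (hΦ : IsCP Φ) : Φ 0 = 0 :=
  hΦ.isLinearMap.map_zero

theorem IsCP.map_sum (hΦ : IsCP Φ) {ι : Type} (s : Finset ι) (f : ι → Matrix α α ℂ) :
    Φ (∑ i ∈ s, f i) = ∑ i ∈ s, Φ (f i) :=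
  _root_.map_sum (hΦ.isLinearMap.mk' Φ) f s

theorem IsCP.posSemidef [Fintype β] (hΦ : IsCP Φ) {ρ : Matrix α α ℂ} (hρ : ρ.PosSemidef) :
    (Φ ρ).PosSemidef := by
  obtain ⟨ι, _, K, hK⟩ := hΦ
  rw [hK]
  exact Matrix.posSemidef_sum _ fun i _ => hρ.mul_mul_conjTranspose_same (K i)

theorem IsCP.onLeft_kronecker (hΦ : IsCP Φ) (A : Matrix α α ℂ) (B : Matrix κ κ ℂ) :
    QCrypto.onLeft Φ (A ⊗ₖ B) = Φ A ⊗ₖ B := by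
  ext ⟨p, k⟩ ⟨q, l⟩
  have : (Matrix.of fun i j => (A ⊗ₖ B) (i, k) (j, l)) = B k l • A := by
    ext i j; simp [mul_comm]
  simp only [QCrypto.onLeft, Matrix.of_apply, this, hΦ.map_smul]
  simp [mul_comm]

theorem IsCP.onRight_kronecker (hΦ : IsCP Φ) (A : Matrix κ κ ℂ) (B : Matrix α α ℂ) :
    QCrypto.onRight Φ (A ⊗ₖ B) = A ⊗ₖ Φ B := by
  ext ⟨p, k⟩ ⟨q, l⟩
  have : (Matrix.of fun i j => (A ⊗ₖ B) (p, i) (q, j)) = A p q • B := by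
    ext i j; simp
  simp only [QCrypto.onRight, Matrix.of_apply, this, hΦ.map_smul]
  simp

end CP

theorem sum_kronecker {α κ ι : Type} (s : Finset ι) (A : ι → Matrix α α ℂ) (B : Matrix κ κ ℂ) :
    (∑ i ∈ s, A i) ⊗ₖ B = ∑ i ∈ s, A i ⊗ₖ B := by
  ext i j
  simp [Matrix.sum_apply, Finset.sum_mul]

/-! ## The operations of circuits -/

theorem isCP_coin : IsCP (QGate.denote .coin) := by
  refine ⟨Bool, inferInstance, fun y => Matrix.single y () (((Real.sqrt 2 : ℝ) : ℂ)⁻¹),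
    fun ρ => ?_⟩
  have h : ((Real.sqrt 2 : ℝ) : ℂ)⁻¹ * ((Real.sqrt 2 : ℝ) : ℂ)⁻¹ = 2⁻¹ := by
    rw [← mul_inv, ← Complex.ofReal_mul, Real.mul_self_sqrt (by norm_num)]
    simp
  change Matrix.diagonal _ = _
  ext i j
  have : ∀ z : ℂ, ((Real.sqrt 2 : ℝ) : ℂ)⁻¹ * z * ((Real.sqrt 2 : ℝ) : ℂ)⁻¹ = z / 2 := by
    intro z; rw [mul_right_comm, h]; ring
  cases i <;> cases j <;> simp [this]

theorem isCP_classical {a b : Wires} (c : BCirc a b) : IsCP (QGate.denote (.classical c)) := by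
  refine ⟨a.val, inferInstance, fun x => Matrix.single (c.eval x) x 1, fun ρ => ?_⟩
  change Matrix.diagonal _ = _
  ext i j
  rw [Matrix.sum_apply, Matrix.diagonal_apply]
  split_ifs with h
  · subst h
    refine Finset.sum_congr rfl fun x _ => ?_
    rw [Matrix.conjTranspose_single, Matrix.single_mul_mul_single]
    simp [Matrix.single_apply]
  · symm
    refine Finset.sum_eq_zero fun x _ => ?_
    rw [Matrix.conjTranspose_single, Matrix.single_mul_mul_single, Matrix.single_apply,
      if_neg]
    rintro ⟨rfl, rfl⟩
    exact h rfl

theorem QGate.isCP : ∀ {a b : Wires} (g : QGate a b), IsCP g.denote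
  | _, _, .hadamard => IsCP.conj _
  | _, _, .phase => IsCP.conj _
  | _, _, .cnot => IsCP.submatrix _
  | _, _, .coin => isCP_coin
  | _, _, .classical c => isCP_classical c

/-- Rewirings and the identity are reindexings, hence conjugations by 0/1 matrices. Trace
preservation is not needed anywhere. -/
theorem QCirc.isCP {a b : Wires} (C : QCirc a b) : IsCP C.denote := by
  induction C with
  | id a => exact IsCP.submatrix (fun x => x)
  | seq f g ihf ihg => exact ihg.comp ihf
  | par f g ihf ihg => exact (ihg.onRight).comp ihf.onLeft
  | gate g => exact g.isCP
  | _ => exact IsCP.submatrix _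

theorem denote_seq {a b c : Wires} (f : QCirc a b) (g : QCirc b c) (ρ : Op a) :
    QCirc.denote (.seq f g) ρ = g.denote (f.denote ρ) :=
  rfl

theorem denote_id {a : Wires} (ρ : Op a) : QCirc.denote (.id a) ρ = ρ :=
  rfl

theorem denote_par_kronecker {a b c d : Wires} (f : QCirc a b) (g : QCirc c d) (A : Op a)
    (B : Op c) :
    QCirc.denote (.par f g) (A ⊗ₖ B : Op (a ⊠ c)) = (f.denote A ⊗ₖ g.denote B : Op (b ⊠ d)) :=
  (congrArg _ (f.isCP.onLeft_kronecker A B)).trans (g.isCP.onRight_kronecker _ B)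

theorem denote_swap_kronecker {a b : Wires} (A : Op a) (B : Op b) :
    QCirc.denote (.swap a b) (A ⊗ₖ B : Op (a ⊠ b)) = (B ⊗ₖ A : Op (b ⊠ a)) := by
  ext i j
  exact mul_comm _ _

theorem denote_assoc_kronecker {a b c : Wires} (A : Op a) (B : Op b) (C : Op c) :
    QCirc.denote (.assoc a b c) ((A ⊗ₖ B : Op (a ⊠ b)) ⊗ₖ C : Op ((a ⊠ b) ⊠ c)) =
      (A ⊗ₖ (B ⊗ₖ C : Op (b ⊠ c)) : Op (a ⊠ b ⊠ c)) := by
  ext i j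
  exact mul_assoc _ _ _

theorem denote_assocInv_kronecker {a b c : Wires} (A : Op a) (B : Op b) (C : Op c) :
    QCirc.denote (.assocInv a b c) (A ⊗ₖ (B ⊗ₖ C : Op (b ⊠ c)) : Op (a ⊠ b ⊠ c)) =
      ((A ⊗ₖ B : Op (a ⊠ b)) ⊗ₖ C : Op ((a ⊠ b) ⊠ c)) := by
  ext i j
  exact (mul_assoc _ _ _).symm

theorem denote_exch_kronecker {a b c : Wires} (A : Op a) (B : Op b) (C : Op c) :
    QCirc.denote (exch a b c) (A ⊗ₖ (B ⊗ₖ C : Op (b ⊠ c)) : Op (a ⊠ b ⊠ c)) =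
      (B ⊗ₖ (A ⊗ₖ C : Op (a ⊠ c)) : Op (b ⊠ a ⊠ c)) := by
  ext i j
  exact mul_left_comm _ _ _

theorem denote_unitLInv {a : Wires} (A : Op a) :
    QCirc.denote (.unitLInv a) A = ((ket () : Op .unit) ⊗ₖ A : Op (.unit ⊠ a)) := by
  ext i j
  change A i.2 j.2 = Matrix.single () () 1 i.1 j.1 * A i.2 j.2
  simp

theorem ket_kronecker_ket {a b : Wires} (x : a.val) (y : b.val) :
    (ket x ⊗ₖ ket y : Op (a ⊠ b)) = ket (w := a ⊠ b) (x, y) := by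
  ext ⟨i, j⟩ ⟨k, l⟩
  simp only [ket, Matrix.kroneckerMap_apply, Matrix.single_apply, Prod.mk.injEq]
  split_ifs <;> grind

theorem denote_classical {a b : Wires} (c : BCirc a b) (ρ : Op a) :
    QCirc.denote (.gate (.classical c)) ρ = ∑ x, ρ x x • ket (c.eval x) := by
  change Matrix.diagonal _ = _
  ext i j
  simp only [ket, Matrix.diagonal_apply, Matrix.sum_apply, Matrix.smul_apply,
    Matrix.single_apply, smul_eq_mul, mul_ite, mul_one, mul_zero]
  split_ifs with h
  · subst h
    simp
  · symm
    refine Finset.sum_eq_zero fun x _ => if_neg ?_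
    rintro ⟨rfl, rfl⟩
    exact h rfl

theorem denote_classical_ket {a b : Wires} (c : BCirc a b) (x : a.val) :
    QCirc.denote (.gate (.classical c)) (ket x) = ket (c.eval x) := by
  rw [denote_classical, Finset.sum_eq_single x]
  · simp [ket]
  · intro y _ h
    simp [ket, h.symm]
  · simp

theorem denote_dup_ket {a : Wires} (x : a.val) :
    QCirc.denote (dup a) (ket x) = (ket x ⊗ₖ ket x : Op (a ⊠ a)) := by
  rw [ket_kronecker_ket]
  exact denote_classical_ket _ _

theorem posSemidef_ket {a : Wires} (x : a.val) : (ket x).PosSemidef := by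
  have := (Matrix.PosSemidef.one (n := Unit) (R := ℂ)).mul_mul_conjTranspose_same
    (Matrix.single x () (1 : ℂ))
  simpa [ket, Matrix.conjTranspose_single] using this

/-- Independent fair coins form the maximally mixed state. The input is one-dimensional, so it
contributes only the scalar `ρ () ()`. -/
theorem denote_coins (w : Wires) (ρ : Op .unit) :
    (coins w).denote ρ = ((Fintype.card w.val : ℂ)⁻¹ * ρ () ()) • (1 : Op w) := by
  induction w generalizing ρ with
  | unit =>
    ext i j
    change ρ i j = _
    simp
  | bit =>
    change Matrix.diagonal _ = _
    rw [← Matrix.diagonal_one, ← Matrix.diagonal_smul]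
    congr 1
    funext i
    simp
    ring
  | tensor a b iha ihb =>
    have hρ : ρ = ρ () () • ket (w := .unit) () := by
      ext i j; simp [ket]
    have h : QCirc.denote (coins (a ⊠ b)) ρ =
        ρ () () •
          QCirc.denote (.par (coins a) (coins b)) (QCirc.denote (.unitLInv _) (ket ())) := by
      conv_lhs => rw [hρ, QCirc.isCP _ |>.map_smul]
      rfl
    rw [h, denote_unitLInv, denote_par_kronecker, iha, ihb, Matrix.smul_kronecker,
      Matrix.kronecker_smul, Matrix.one_kronecker_one, smul_smul, smul_smul]
    have hc : Fintype.card (a ⊠ b).val = Fintype.card a.val * Fintype.card b.val :=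
      Fintype.card_prod _ _
    rw [hc]
    simp only [ket, Matrix.single_apply_same, mul_one, Nat.cast_mul, mul_inv]
    congr 1
    ring

/-- The state of a register filled with the output of a randomized algorithm. -/
def outputState {r b : Wires} (f : r.val → b.val) : Op b :=
  (Fintype.card r.val : ℂ)⁻¹ • ∑ s, ket (f s)

theorem denote_sample {a r b : Wires} (c : BCirc (a ⊠ r) b) (ρ : Op a) :
    (sample c).denote ρ = ∑ x, ρ x x • outputState fun s => c.eval (x, s) := by
  change QCirc.denote (.gate (.classical c)) (QCirc.denote (.par (.id a) (coins r))
    (QCirc.denote (.swap _ _) (QCirc.denote (.unitLInv a) ρ))) = _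
  rw [denote_unitLInv, denote_swap_kronecker, denote_par_kronecker, denote_coins,
    denote_classical]
  refine (Fintype.sum_prod_type _).trans (Finset.sum_congr rfl fun x _ => ?_)
  rw [outputState, Finset.smul_sum, Finset.smul_sum]
  refine Finset.sum_congr rfl fun s _ => ?_
  rw [smul_smul]
  congr 1
  change ρ x x * _ = _
  simp [ket]

/-- Running a classical sampler measures its input implicitly, so a correlated side register is left
in the conditional state `condOn ρ x`. This reproduces the measurement of the query in the game. -/
theorem denote_sample_par_id {a r b d : Wires} (c : BCirc (a ⊠ r) b) (ρ : Op (a ⊠ d)) :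
    QCirc.denote (.par (sample c) (.id d)) ρ =
      ∑ x, ((outputState fun s => c.eval (x, s)) ⊗ₖ condOn ρ x : Op (b ⊠ d)) := by
  ext i j
  change (sample c).denote (Matrix.of fun p q => ρ (p, i.2) (q, j.2)) i.1 j.1 = _
  rw [denote_sample, Matrix.sum_apply, Matrix.sum_apply]
  refine Finset.sum_congr rfl fun x _ => ?_
  exact mul_comm _ _

/-! ## The reduction -/

section Reduction

variable {fpk msk spk dk F st sk X D R : Wires}

/-- Measure the query `f`, generate a functional key for it, and run the second stage of the
pirate. -/
def afterQuery {r : Wires} (kg : BCirc ((msk ⊠ F) ⊠ r) sk) (run : QCirc (st ⊠ sk ⊠ dk) R) :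
    QCirc (msk ⊠ (F ⊠ st) ⊠ dk) R :=
  .seq (.seq (.par (.id msk) (.assoc F st dk)) (.assocInv msk F (st ⊠ dk)))
    (.seq (.par (sample kg) (.id (st ⊠ dk))) (.seq (exch sk st dk) run))

/-- Add a classical string to the classical part of a state. -/
def addKey (fpk X D R : Wires) : QCirc (fpk ⊠ (X ⊠ X ⊠ D) ⊠ R) ((X ⊠ X ⊠ fpk ⊠ D) ⊠ R) :=
  .seq (.assocInv fpk (X ⊠ X ⊠ D) R) <|
  .par (.seq (exch fpk X (X ⊠ D)) (.par (.id X) (exch fpk X D))) (.id R)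

/-- Run the pirate of the nested scheme on a given single-decryptor key, with functional
encryption keys generated by the reduction, and add the functional encryption key to the output. -/
def reduction {r r' : Wires} (setup : BCirc (.unit ⊠ r) (fpk ⊠ msk))
    (kg : BCirc ((msk ⊠ F) ⊠ r') sk) (query : QCirc (fpk ⊠ spk) (F ⊠ st))
    (run : QCirc (st ⊠ sk ⊠ dk) ((X ⊠ X ⊠ D) ⊠ R)) :
    QCirc (spk ⊠ dk) ((X ⊠ X ⊠ fpk ⊠ D) ⊠ R) :=
  .seq (.seq (.unitLInv _) (.par (sample setup) (.id _))) <|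
  .seq (.par (.par (dup fpk) (.id msk)) (.id (spk ⊠ dk))) <|
  .seq (.seq (.assoc (fpk ⊠ fpk) msk (spk ⊠ dk)) (.assoc fpk fpk (msk ⊠ spk ⊠ dk))) <|
  .seq (.par (.id fpk) (.seq (exch fpk msk (spk ⊠ dk))
    (.par (.id msk) (.assocInv fpk spk dk)))) <|
  .seq (.par (.id fpk) (.seq (.par (.id msk) (.par query (.id dk))) (afterQuery kg run))) <|
  addKey fpk X D R

/-- The final state of the pirate after measuring its query `f`, given the state `ρ` after the
query and the quantum part `σ` of the key. -/
def finalState {r : Wires} (kg : BCirc ((msk ⊠ F) ⊠ r) sk) (run : QCirc (st ⊠ sk ⊠ dk) R)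
    (ρ : Op (F ⊠ st)) (σ : Op dk) (k : msk.val) (f : F.val) : Op R :=
  run.denote (condOn ρ f ⊗ₖ ((outputState fun s => kg.eval ((k, f), s)) ⊗ₖ σ : Op (sk ⊠ dk)) :
    Op (st ⊠ sk ⊠ dk))

/-- Key generation measures `msk` and the query together. The former is the basis state `k`, so only
the sum over queries survives. -/
theorem denote_afterQuery {r : Wires} (kg : BCirc ((msk ⊠ F) ⊠ r) sk)
    (run : QCirc (st ⊠ sk ⊠ dk) R) (k : msk.val) (ρ : Op (F ⊠ st)) (σ : Op dk) :
    (afterQuery kg run).denote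
        (ket k ⊗ₖ (ρ ⊗ₖ σ : Op ((F ⊠ st) ⊠ dk)) : Op (msk ⊠ (F ⊠ st) ⊠ dk)) =
      ∑ f, finalState kg run ρ σ k f := by
  -- After rebracketing, the block belonging to a measured pair vanishes unless its master key is
  -- `k`.
  have h : ∀ x : (msk ⊠ F).val, condOn (a := msk ⊠ F) (b := st ⊠ dk)
      (QCirc.denote (.seq (.par (.id msk) (.assoc F st dk)) (.assocInv msk F (st ⊠ dk)))
        (ket k ⊗ₖ (ρ ⊗ₖ σ : Op ((F ⊠ st) ⊠ dk)) : Op (msk ⊠ (F ⊠ st) ⊠ dk))) x =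
      if x.1 = k then (condOn ρ x.2 ⊗ₖ σ : Op (st ⊠ dk)) else 0 := by
    intro x
    ext i j
    change Matrix.single k k (1 : ℂ) x.1 x.1 * (ρ (x.2, i.1) (x.2, j.1) * σ i.2 j.2) = _
    split_ifs with h
    · rw [h, Matrix.single_apply_same, one_mul]; rfl
    · simp [Ne.symm h]
  change run.denote (QCirc.denote (exch sk st dk) (QCirc.denote (.par (sample kg) (.id (st ⊠ dk)))
    (QCirc.denote (.seq (.par (.id msk) (.assoc F st dk)) (.assocInv msk F (st ⊠ dk))) _))) = _
  rw [denote_sample_par_id, (QCirc.isCP _).map_sum, (QCirc.isCP _).map_sum]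
  refine (Fintype.sum_prod_type _).trans ?_
  rw [Finset.sum_eq_single k]
  · refine Finset.sum_congr rfl fun f _ => ?_
    rw [h, if_pos rfl, denote_exch_kronecker]
    rfl
  · intro x _ hx
    refine Finset.sum_eq_zero fun f _ => ?_
    rw [h, if_neg hx, Matrix.kronecker_zero, (QCirc.isCP _).map_zero, (QCirc.isCP _).map_zero]
  · simp

theorem condOn_denote_addKey (k k' : fpk.val) (x₀ x₁ : X.val) (s : D.val)
    (ρ : Op ((X ⊠ X ⊠ D) ⊠ R)) :
    condOn (a := X ⊠ X ⊠ fpk ⊠ D) (QCirc.denote (addKey fpk X D R)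
      (ket k ⊗ₖ ρ : Op (fpk ⊠ (X ⊠ X ⊠ D) ⊠ R))) (x₀, x₁, k', s) =
      if k = k' then condOn (a := X ⊠ X ⊠ D) ρ (x₀, x₁, s) else 0 := by
  ext i j
  change Matrix.single k k (1 : ℂ) k' k' * ρ ((x₀, x₁, s), i) ((x₀, x₁, s), j) = _
  split_ifs with h
  · rw [h, Matrix.single_apply_same, one_mul]; rfl
  · simp [h]

/-- Sampling the setup turns the input into a uniform mixture of product states. For each random
string `s` the rewirings act factor by factor, and the copy of `fe.pk` made before the query
survives until `addKey`. -/
theorem denote_reduction {r r' : Wires} (setup : BCirc (.unit ⊠ r) (fpk ⊠ msk))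
    (kg : BCirc ((msk ⊠ F) ⊠ r') sk) (query : QCirc (fpk ⊠ spk) (F ⊠ st))
    (run : QCirc (st ⊠ sk ⊠ dk) ((X ⊠ X ⊠ D) ⊠ R)) (pk : spk.val) (σ : Op dk) :
    (reduction setup kg query run).denote (ket pk ⊗ₖ σ : Op (spk ⊠ dk)) =
      (Fintype.card r.val : ℂ)⁻¹ • ∑ s, (addKey fpk X D R).denote
        (ket (setup.eval ((), s)).1 ⊗ₖ
          ∑ f, finalState kg run (query.denote (ket (w := fpk ⊠ spk) ((setup.eval ((), s)).1, pk)))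
            σ (setup.eval ((), s)).2 f : Op (fpk ⊠ (X ⊠ X ⊠ D) ⊠ R)) := by
  change QCirc.denote (.seq (.par (.par (dup fpk) (.id msk)) (.id (spk ⊠ dk))) <|
    .seq (.seq (.assoc (fpk ⊠ fpk) msk (spk ⊠ dk)) (.assoc fpk fpk (msk ⊠ spk ⊠ dk))) <|
    .seq (.par (.id fpk) (.seq (exch fpk msk (spk ⊠ dk))
      (.par (.id msk) (.assocInv fpk spk dk)))) <|
    .seq (.par (.id fpk) (.seq (.par (.id msk) (.par query (.id dk))) (afterQuery kg run))) <|
      addKey fpk X D R) (QCirc.denote (.par (sample setup) (.id _))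
        (QCirc.denote (.unitLInv _) _)) = _
  rw [denote_unitLInv, denote_par_kronecker, denote_sample, denote_id]
  have h₀ : (∑ x : Wires.unit.val, (ket () : Op .unit) x x •
      outputState fun s => setup.eval (x, s)) = outputState fun s => setup.eval ((), s) := by
    simp [ket]
  rw [h₀, outputState, Matrix.smul_kronecker, (QCirc.isCP _).map_smul, sum_kronecker,
    (QCirc.isCP _).map_sum]
  refine congrArg (HSMul.hSMul (Fintype.card r.val : ℂ)⁻¹) (Finset.sum_congr rfl fun s _ => ?_)
  generalize setup.eval ((), s) = kp
  obtain ⟨k, m⟩ := kp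
  rw [← ket_kronecker_ket k m, ← ket_kronecker_ket k pk, ← denote_afterQuery]
  simp only [denote_seq]
  rw [denote_par_kronecker, denote_par_kronecker, denote_dup_ket, denote_id (a := msk),
    denote_id (a := spk ⊠ dk), denote_assoc_kronecker, denote_assoc_kronecker,
    denote_par_kronecker, denote_seq, denote_exch_kronecker, denote_par_kronecker,
    denote_par_kronecker, denote_assocInv_kronecker, denote_seq, denote_par_kronecker,
    denote_par_kronecker]
  simp only [denote_id]

end Reduction

/-! ## Positivity of the tests -/

theorem posSemidef_of_isSelfAdjoint_of_mul_self {w : Wires} {A : Op w} (h : IsSelfAdjoint A)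
    (h' : A * A = A) : A.PosSemidef := by
  have := Matrix.posSemidef_conjTranspose_mul_self A
  rwa [show Aᴴ = A from h, h'] at this

/-- The indicator of a point squares to itself, hence so does its functional calculus. No assumption
on `P` is needed, as the calculus always returns a self-adjoint operator. -/
theorem posSemidef_projImp {w : Wires} (P : Op w) (p : ℝ) : (projImp P p).PosSemidef := by
  refine posSemidef_of_isSelfAdjoint_of_mul_self (cfc_predicate _ _) ?_
  -- Any function is continuous on a finite spectrum, including the discontinuous indicator.
  have hc : ∀ f : ℝ → ℝ, ContinuousOn f (spectrum ℝ P) := fun f =>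
    P.finite_real_spectrum.continuousOn f
  rw [projImp, ← cfc_mul _ _ _ (hc _) (hc _)]
  congr 1
  funext x
  split_ifs <;> simp

theorem posSemidef_thresholdImp {w : Wires} (t : ℝ) (P : Op w) :
    (thresholdImp t P).PosSemidef := by
  refine Matrix.posSemidef_sum _ fun p _ => ?_
  split_ifs
  · exact posSemidef_projImp P p
  · exact .zero

/-- The difference is the sum of the spectral projections for eigenvalues in `[t', t)`. This is the
only place where lowering the threshold matters. -/
theorem posSemidef_thresholdImp_sub {w : Wires} {t t' : ℝ} (h : t' ≤ t) (P : Op w) :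
    (thresholdImp t' P - thresholdImp t P).PosSemidef := by
  rw [thresholdImp, thresholdImp, ← Finset.sum_sub_distrib]
  refine Matrix.posSemidef_sum _ fun p _ => ?_
  by_cases h₁ : t ≤ p
  · rw [if_pos h₁, if_pos (h.trans h₁), sub_self]
    exact .zero
  · rw [if_neg h₁, sub_zero]
    split_ifs
    · exact posSemidef_projImp P p
    · exact .zero

section TestProj

variable {Ω : Type} [Fintype Ω] {c : Wires} (R : Wires) (D : Ω → Bool × c.val) (s : List Bool)

theorem posSemidef_testProj (γ : ℝ) : (testProj R γ D s).PosSemidef := by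
  rw [testProj]
  split
  · exact posSemidef_thresholdImp _ _
  · exact .zero

theorem posSemidef_testProj_sub {γ γ' : ℝ} (h : γ' ≤ γ) :
    (testProj R γ' D s - testProj R γ D s).PosSemidef := by
  rw [testProj, testProj]
  split
  · exact posSemidef_thresholdImp_sub (by linarith) _
  · rw [sub_self]
    exact .zero

end TestProj

theorem trace_mul_nonneg {n : Type} [Fintype n] {A B : Matrix n n ℂ} (hA : A.PosSemidef)
    (hB : B.PosSemidef) : 0 ≤ (A * B).trace := by
  obtain ⟨m, v, rfl⟩ := Matrix.posSemidef_iff_eq_sum_vecMulVec.1 hA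
  rw [Matrix.trace_mul_comm, Matrix.mul_sum, Matrix.trace_sum]
  refine Finset.sum_nonneg fun i _ => ?_
  rw [Matrix.mul_vecMulVec, Matrix.trace_vecMulVec, dotProduct_comm]
  exact hB.dotProduct_mulVec_nonneg _

/-- `bothPass` as a linear map on states. -/
def bothPassLin {R₁ R₂ : Wires} (T₁ : Op R₁) (T₂ : Op R₂) : Op (R₁ ⊠ R₂) →ₗ[ℝ] ℝ where
  toFun := bothPass T₁ T₂
  map_add' p q := by simp [bothPass, Matrix.mul_add]
  map_smul' r q := by simp [bothPass]

section BothPass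

variable {R₁ R₂ : Wires} {T₁ T₁' : Op R₁} {T₂ T₂' : Op R₂} {q : Op (R₁ ⊠ R₂)}

theorem bothPass_nonneg (h₁ : T₁.PosSemidef) (h₂ : T₂.PosSemidef) (hq : q.PosSemidef) :
    0 ≤ bothPass T₁ T₂ q :=
  (Complex.le_def.1 (trace_mul_nonneg (h₁.kronecker h₂) hq)).1

theorem bothPass_mono (h₁ : T₁.PosSemidef) (h₂ : T₂'.PosSemidef) (h₁' : (T₁' - T₁).PosSemidef)
    (h₂' : (T₂' - T₂).PosSemidef) (hq : q.PosSemidef) :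
    bothPass T₁ T₂ q ≤ bothPass T₁' T₂' q := by
  have e₁ := bothPass_nonneg h₁' h₂ hq
  have e₂ := bothPass_nonneg h₁ h₂' hq
  -- Telescoping changes one tensor factor at a time, so each term is a product of positive
  -- operators.
  have h : bothPass T₁' T₂' q - bothPass T₁ T₂ q =
      bothPass (T₁' - T₁) T₂' q + bothPass T₁ (T₂' - T₂) q := by
    have hs : ∀ (A A' : Op R₁) (B : Op R₂), (A' - A) ⊗ₖ B = A' ⊗ₖ B - A ⊗ₖ B := by
      intro A A' B; ext i j; simp [sub_mul]
    have hs' : ∀ (A : Op R₁) (B B' : Op R₂), A ⊗ₖ (B' - B) = A ⊗ₖ B' - A ⊗ₖ B := by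
      intro A B B'; ext i j; simp [mul_sub]
    simp only [bothPass, hs, hs', Matrix.sub_mul, Matrix.trace_sub, Complex.sub_re]
    ring
  linarith

end BothPass

/-! ## The winning probability of the reduction -/

section Winning

variable {fpk X D R : Wires}

theorem posSemidef_condOn {a b : Wires} {ρ : Op (a ⊠ b)} (h : ρ.PosSemidef) (x : a.val) :
    (condOn ρ x).PosSemidef :=
  h.submatrix _

theorem condOn_sum {a b : Wires} {ι : Type} (s : Finset ι) (ρ : ι → Op (a ⊠ b)) (x : a.val) :
    condOn (∑ i ∈ s, ρ i) x = ∑ i ∈ s, condOn (ρ i) x := by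
  ext i j
  simp [condOn, Matrix.sum_apply]

theorem posSemidef_outputState {r b : Wires} (f : r.val → b.val) :
    (outputState f).PosSemidef := by
  refine Matrix.PosSemidef.smul (Matrix.posSemidef_sum _ fun _ _ => posSemidef_ket _) ?_
  exact inv_nonneg.2 (Nat.cast_nonneg _)

/-- The added key is a deterministic label of each branch `s`, so the sum over announced keys
collapses to `k s`. Linearity of `V o` is what allows the mixture over `s` to be pulled out. -/
theorem sum_condOn_addKey {r : Wires} (V : (X ⊠ X ⊠ fpk ⊠ D).val → Op R →ₗ[ℝ] ℝ)
    (k : r.val → fpk.val) (τ : r.val → Op ((X ⊠ X ⊠ D) ⊠ R)) :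
    ∑ o, V o (condOn (a := X ⊠ X ⊠ fpk ⊠ D) ((Fintype.card r.val : ℂ)⁻¹ • ∑ s,
        (addKey fpk X D R).denote (ket (k s) ⊗ₖ τ s : Op (fpk ⊠ (X ⊠ X ⊠ D) ⊠ R))) o) =
      avg fun s => ∑ o : (X ⊠ X ⊠ D).val,
        V (o.1, o.2.1, k s, o.2.2) (condOn (a := X ⊠ X ⊠ D) (τ s) o) := by
  have h : ∀ o : (X ⊠ X ⊠ fpk ⊠ D).val,
      V o (condOn (a := X ⊠ X ⊠ fpk ⊠ D) ((Fintype.card r.val : ℂ)⁻¹ • ∑ s,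
        (addKey fpk X D R).denote (ket (k s) ⊗ₖ τ s : Op (fpk ⊠ (X ⊠ X ⊠ D) ⊠ R))) o) =
      (Fintype.card r.val : ℝ)⁻¹ * ∑ s, if k s = o.2.2.1 then
        V o (condOn (a := X ⊠ X ⊠ D) (τ s) (o.1, o.2.1, o.2.2.2)) else 0 := by
    rintro ⟨x₀, x₁, k', d⟩
    have e : condOn (a := X ⊠ X ⊠ fpk ⊠ D) ((Fintype.card r.val : ℂ)⁻¹ • ∑ s,
        (addKey fpk X D R).denote (ket (k s) ⊗ₖ τ s : Op (fpk ⊠ (X ⊠ X ⊠ D) ⊠ R)))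
        (x₀, x₁, k', d) = (Fintype.card r.val : ℝ)⁻¹ • ∑ s, if k s = k' then
          condOn (a := X ⊠ X ⊠ D) (τ s) (x₀, x₁, d) else 0 := by
      rw [← Finset.sum_congr rfl fun s _ => condOn_denote_addKey (k s) k' x₀ x₁ d (τ s),
        ← condOn_sum]
      ext i j
      simp [condOn]
    rw [e, map_smul, map_sum, smul_eq_mul]
    congr 1
    refine Finset.sum_congr rfl fun s _ => ?_
    rw [apply_ite (V _), map_zero]
  rw [Finset.sum_congr rfl fun o _ => h o, ← Finset.mul_sum, Finset.sum_comm]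
  unfold avg
  congr 1
  refine Finset.sum_congr rfl fun s _ => ?_
  have e : ∀ (g : (X ⊠ X ⊠ fpk ⊠ D).val → ℝ), ∑ o, g o =
      ∑ x₀, ∑ x₁, ∑ k', ∑ d, g (x₀, x₁, k', d) := by
    intro g
    refine (Fintype.sum_prod_type _).trans (Finset.sum_congr rfl fun _ _ => ?_)
    refine (Fintype.sum_prod_type _).trans (Finset.sum_congr rfl fun _ _ => ?_)
    exact Fintype.sum_prod_type _
  have e' : ∀ (g : (X ⊠ X ⊠ D).val → ℝ), ∑ o, g o = ∑ x₀, ∑ x₁, ∑ d, g (x₀, x₁, d) := by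
    intro g
    refine (Fintype.sum_prod_type _).trans (Finset.sum_congr rfl fun _ _ => ?_)
    exact Fintype.sum_prod_type _
  beta_reduce
  rw [e, e']
  refine Finset.sum_congr rfl fun x₀ _ => Finset.sum_congr rfl fun x₁ _ => ?_
  rw [Finset.sum_comm]
  refine Finset.sum_congr rfl fun d _ => ?_
  exact Finset.sum_ite_eq _ (k s) (fun k' => V (x₀, x₁, k', d)
    (condOn (a := X ⊠ X ⊠ D) (τ s) (x₀, x₁, d))) |>.trans (if_pos (Finset.mem_univ _))

/-- The second component is averaged outermost, to match the SDE game, whose setup randomness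
precedes that of the reduction. -/
theorem avg_tensor {a b : Wires} (f : (a ⊠ b).val → ℝ) :
    avg f = avg fun y : b.val => avg fun x : a.val => f (x, y) := by
  have hc : Fintype.card (a ⊠ b).val = Fintype.card a.val * Fintype.card b.val :=
    Fintype.card_prod _ _
  have hs : ∑ x, f x = ∑ y, ∑ x, f (x, y) := Fintype.sum_prod_type_right _
  rw [avg, hc, hs, avg]
  simp only [avg, ← Finset.mul_sum, Nat.cast_mul, mul_inv]
  ring

theorem avg_mono {w : Wires} {f g : w.val → ℝ} (h : ∀ r, f r ≤ g r) : avg f ≤ avg g :=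
  mul_le_mul_of_nonneg_left (Finset.sum_le_sum fun r _ => h r)
    (inv_nonneg.2 (Nat.cast_nonneg _))

theorem avg_nonneg {w : Wires} {f : w.val → ℝ} (h : ∀ r, 0 ≤ f r) : 0 ≤ avg f :=
  mul_nonneg (inv_nonneg.2 (Nat.cast_nonneg _)) (Finset.sum_nonneg fun r _ => h r)

end Winning

/-! ## Security of the nested scheme -/

section Nested

variable {𝓕 : FunClass} {C : ℕ → Wires} {fe : PKFE 𝓕 C} {sde : SDE C}

/-- The pirate against the single-decryptor encryption scheme that generates the functional
encryption keys itself and runs a pirate against the nested scheme. -/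
def reductionPirate (A : SDFEPirate (nested fe sde))
    (setup : ∀ n, BCirc (.unit ⊠ fe.setupRand n) (fe.pk n ⊠ fe.msk n))
    (kg : ∀ n, BCirc ((fe.msk n ⊠ 𝓕.F n) ⊠ fe.kgRand n) (fe.sk n)) :
    SDEPirate sde fe.encFamily where
  d₁ := A.d₁
  d₂ := A.d₂
  R₁ := A.R₁
  R₂ := A.R₂
  run n := reduction (spk := sde.pk n) (dk := sde.dk n) (X := 𝓕.X n) (D := A.d₁ n ⊠ A.d₂ n)
    (R := A.R₁ n ⊠ A.R₂ n) (st := A.st n) (setup n) (kg n) (A.query n) (A.run n)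

theorem qkg_nested {n : ℕ} {kg : BCirc ((fe.msk n ⊠ 𝓕.F n) ⊠ fe.kgRand n) (fe.sk n)}
    (hkg : ∀ x s, kg.eval (x, s) = fe.kg n x.1 x.2 s) (k : (fe.msk n).val) (k' : (sde.sk n).val)
    (f : (𝓕.F n).val) :
    (nested fe sde).qkg n (k, k') f =
      ((outputState fun s => kg.eval ((k, f), s)) ⊗ₖ sde.qkg n k' : Op (fe.sk n ⊠ sde.dk n)) := by
  rw [outputState, Matrix.smul_kronecker, sum_kronecker]
  simp only [hkg]
  rfl

open Classical in
/-- Both tests of the single-decryptor game, as a function of the classical output of the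
adversary. -/
def gameValue (fe : PKFE 𝓕 C) (sde : SDE C) (n : ℕ) (d₁ d₂ R₁ R₂ : Wires) (γ : ℝ)
    (pk : (sde.pk n).val) (o : (𝓕.X n ⊠ 𝓕.X n ⊠ fe.pk n ⊠ d₁ ⊠ d₂).val) :
    Op (R₁ ⊠ R₂) →ₗ[ℝ] ℝ :=
  if o.1 ∈ 𝓕.plaintexts n ∧ o.2.1 ∈ 𝓕.plaintexts n ∧ o.2.2.1 ∈ fe.encFamily.keys n then
    bothPassLin
      (testProj R₁ γ (sde.challenge fe.encFamily n pk o.2.2.1 o.1 o.2.1) (d₁.toBits o.2.2.2.1))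
      (testProj R₂ γ (sde.challenge fe.encFamily n pk o.2.2.1 o.1 o.2.1) (d₂.toBits o.2.2.2.2))
  else 0

variable {A : SDFEPirate (nested fe sde)}
  {setup : ∀ n, BCirc (.unit ⊠ fe.setupRand n) (fe.pk n ⊠ fe.msk n)}
  {kg : ∀ n, BCirc ((fe.msk n ⊠ 𝓕.F n) ⊠ fe.kgRand n) (fe.sk n)}

/-- The final state of a pirate in the game with given keys, if its query is `f`. -/
def pirateState (A : SDFEPirate (nested fe sde))
    (kg : ∀ n, BCirc ((fe.msk n ⊠ 𝓕.F n) ⊠ fe.kgRand n) (fe.sk n)) (n : ℕ)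
    (r : (fe.setupRand n).val) (r' : (sde.setupRand n).val) (f : (𝓕.F n).val) :
    Op ((𝓕.X n ⊠ 𝓕.X n ⊠ A.d₁ n ⊠ A.d₂ n) ⊠ (A.R₁ n ⊠ A.R₂ n)) :=
  finalState (st := A.st n) (dk := sde.dk n) (kg n) (A.run n)
    (QCirc.denote (A.query n)
      (ket (w := fe.pk n ⊠ sde.pk n) ((fe.setup n r).1, (sde.setup n r').1)))
    (sde.qkg n (sde.setup n r').2) (fe.setup n r).2 f

/-- The PKFE randomness, internal to the adversary in the SDE game, becomes an explicit average, and
the game value is evaluated at the sampled `fe.pk`. -/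
theorem winProb_reductionPirate
    (hsetup : ∀ n x s, (setup n).eval (x, s) = fe.setup n s) (n : ℕ) (γ : ℝ) :
    (reductionPirate A setup kg).winProb n γ =
      avg fun r' : (sde.setupRand n).val => avg fun r : (fe.setupRand n).val =>
        ∑ o : (𝓕.X n ⊠ 𝓕.X n ⊠ A.d₁ n ⊠ A.d₂ n).val,
          gameValue fe sde n (A.d₁ n) (A.d₂ n) (A.R₁ n) (A.R₂ n) γ (sde.setup n r').1
            (o.1, o.2.1, (fe.setup n r).1, o.2.2)
            (condOn (∑ f, pirateState A kg n r r' f) o) := by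
  classical
  unfold SDEPirate.winProb
  refine congrArg avg (funext fun r' => ?_)
  have e := denote_reduction (spk := sde.pk n) (dk := sde.dk n) (X := 𝓕.X n)
    (D := A.d₁ n ⊠ A.d₂ n) (R := A.R₁ n ⊠ A.R₂ n) (st := A.st n) (setup n) (kg n) (A.query n)
    (A.run n) (sde.setup n r').1 (sde.qkg n (sde.setup n r').2)
  simp only [hsetup] at e
  refine Eq.trans (Finset.sum_congr rfl fun o _ => ?_)
    (sum_condOn_addKey (gameValue fe sde n (A.d₁ n) (A.d₂ n) (A.R₁ n) (A.R₂ n) γ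
      (sde.setup n r').1) (fun r => (fe.setup n r).1) (fun r => ∑ f, pirateState A kg n r r' f))
  obtain ⟨x₀, x₁, k, s₁, s₂⟩ := o
  unfold gameValue
  refine Eq.trans ?_ (apply_ite (fun V : Op (A.R₁ n ⊠ A.R₂ n) →ₗ[ℝ] ℝ => V _) _ _ _).symm
  refine if_congr Iff.rfl ?_ rfl
  exact congrArg (fun ρ => bothPass _ _ (condOn ρ _)) e

open Classical in
/-- The probability of passing both tests of the game for the nested scheme, as a function of the
output of the adversary. -/
def nestedValue (fe : PKFE 𝓕 C) (sde : SDE C) (n : ℕ) (d₁ d₂ R₁ R₂ : Wires) (γ : ℝ)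
    (pk : (fe.pk n).val) (pk' : (sde.pk n).val) (f : (𝓕.F n).val)
    (o : (𝓕.X n ⊠ 𝓕.X n ⊠ d₁ ⊠ d₂).val) (q : Op (R₁ ⊠ R₂)) : ℝ :=
  if f ∈ 𝓕.functions n ∧ o.1 ∈ 𝓕.plaintexts n ∧ o.2.1 ∈ 𝓕.plaintexts n ∧
      𝓕.eval n f o.1 ≠ 𝓕.eval n f o.2.1 then
    bothPass
      (testProj R₁ γ (sde.challenge fe.encFamily n pk' pk o.1 o.2.1) (d₁.toBits o.2.2.1))
      (testProj R₂ γ (sde.challenge fe.encFamily n pk' pk o.1 o.2.1) (d₂.toBits o.2.2.2)) q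
  else 0

/-- Both games now refer to the same `pirateState`. The nested challenge distribution has been
replaced by the SDE one for the encryption family; the two agree by definition, with encryption
randomness the pair of PKFE and SDE randomness. -/
theorem winProb_nested (hkg : ∀ n x s, (kg n).eval (x, s) = fe.kg n x.1 x.2 s) (n : ℕ) (γ : ℝ) :
    A.winProb n γ =
      avg fun r' : (sde.setupRand n).val => avg fun r : (fe.setupRand n).val =>
        ∑ f, ∑ o, nestedValue fe sde n (A.d₁ n) (A.d₂ n) (A.R₁ n) (A.R₂ n) γ (fe.setup n r).1
          (sde.setup n r').1 f o (condOn (pirateState A kg n r r' f) o) := by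
  classical
  unfold SDFEPirate.winProb
  refine (avg_tensor (a := fe.setupRand n) (b := sde.setupRand n) _).trans ?_
  refine congrArg avg (funext fun r' => congrArg avg (funext fun r => ?_))
  refine Finset.sum_congr rfl fun f _ => Finset.sum_congr rfl fun o _ => ?_
  obtain ⟨x₀, x₁, s₁, s₂⟩ := o
  refine if_congr Iff.rfl ?_ rfl
  have e := qkg_nested (sde := sde) (hkg n) (fe.setup n r).2 (sde.setup n r').2 f
  exact congrArg (fun σ => bothPass _ _ (condOn (QCirc.denote (A.run n)
    (condOn (QCirc.denote (A.query n) _) f ⊗ₖ σ)) _)) e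

theorem nestedValue_nonneg {n : ℕ} {d₁ d₂ R₁ R₂ : Wires} {γ : ℝ} {pk : (fe.pk n).val}
    {pk' : (sde.pk n).val} {f : (𝓕.F n).val} {o : (𝓕.X n ⊠ 𝓕.X n ⊠ d₁ ⊠ d₂).val}
    {q : Op (R₁ ⊠ R₂)} (hq : q.PosSemidef) :
    0 ≤ nestedValue fe sde n d₁ d₂ R₁ R₂ γ pk pk' f o q := by
  unfold nestedValue
  split_ifs
  · exact bothPass_nonneg (posSemidef_testProj _ _ _ _) (posSemidef_testProj _ _ _ _) hq
  · exact le_rfl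

/-- The SDE game drops the conditions on `f`, and its remaining key condition holds by `hpk`. If the
nested conditions fail, the left side is zero and positivity suffices; otherwise monotonicity in the
threshold applies. -/
theorem nestedValue_le_gameValue {n : ℕ} {d₁ d₂ R₁ R₂ : Wires} {γ γ' : ℝ} (h : γ' ≤ γ)
    {pk : (fe.pk n).val} (hpk : pk ∈ fe.encFamily.keys n) {pk' : (sde.pk n).val}
    {f : (𝓕.F n).val} {o : (𝓕.X n ⊠ 𝓕.X n ⊠ d₁ ⊠ d₂).val} {q : Op (R₁ ⊠ R₂)}
    (hq : q.PosSemidef) :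
    nestedValue fe sde n d₁ d₂ R₁ R₂ γ pk pk' f o q ≤
      gameValue fe sde n d₁ d₂ R₁ R₂ γ' pk' (o.1, o.2.1, pk, o.2.2) q := by
  unfold nestedValue gameValue
  by_cases hc : o.1 ∈ 𝓕.plaintexts n ∧ o.2.1 ∈ 𝓕.plaintexts n
  · rw [if_pos (show _ ∧ _ ∧ _ from ⟨hc.1, hc.2, hpk⟩)]
    split_ifs
    · exact bothPass_mono (posSemidef_testProj _ _ _ _) (posSemidef_testProj _ _ _ _)
        (posSemidef_testProj_sub _ _ _ h) (posSemidef_testProj_sub _ _ _ h) hq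
    · exact bothPass_nonneg (posSemidef_testProj _ _ _ _) (posSemidef_testProj _ _ _ _) hq
  · rw [if_neg fun h' => hc ⟨h'.2.1, h'.2.2.1⟩, if_neg fun h' => hc ⟨h'.1, h'.2.1⟩]
    exact le_rfl

theorem posSemidef_pirateState (hqkg : ∀ n k, (sde.qkg n k).PosSemidef) (n : ℕ)
    (r : (fe.setupRand n).val) (r' : (sde.setupRand n).val) (f : (𝓕.F n).val) :
    (pirateState A kg n r r' f).PosSemidef :=
  (QCirc.isCP _).posSemidef <|
    (posSemidef_condOn ((QCirc.isCP _).posSemidef (posSemidef_ket _)) f).kronecker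
      ((posSemidef_outputState _).kronecker (hqkg _ _))

theorem winProb_nonneg_and_le_winProb_reductionPirate
    (hsetup : ∀ n x s, (setup n).eval (x, s) = fe.setup n s)
    (hkg : ∀ n x s, (kg n).eval (x, s) = fe.kg n x.1 x.2 s)
    (hqkg : ∀ n k, (sde.qkg n k).PosSemidef) (n : ℕ) {γ γ' : ℝ} (h : γ' ≤ γ) :
    0 ≤ A.winProb n γ ∧ A.winProb n γ ≤ (reductionPirate A setup kg).winProb n γ' := by
  have hpos := fun r r' f =>
    posSemidef_condOn (posSemidef_pirateState (A := A) (kg := kg) hqkg n r r' f)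
  rw [winProb_nested hkg, winProb_reductionPirate hsetup]
  constructor
  · exact avg_nonneg fun r' => avg_nonneg fun r => Finset.sum_nonneg fun f _ =>
      Finset.sum_nonneg fun o _ => nestedValue_nonneg (hpos r r' f o)
  · refine avg_mono fun r' => avg_mono fun r => ?_
    rw [Finset.sum_comm]
    refine Finset.sum_le_sum fun o _ => ?_
    -- The reduction forgets `f`, so its state is the sum over queries; linearity splits its value
    -- into the contributions of the single queries.
    rw [condOn_sum, map_sum]
    exact Finset.sum_le_sum fun f _ => nestedValue_le_gameValue h ⟨r, rfl⟩ (hpos r r' f o)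

end Nested

theorem nested_challengeOnlyStrongAntiPiracy {𝓕 : FunClass} {C : ℕ → Wires} {fe : PKFE 𝓕 C}
    {sde : SDE C} (hfe : fe.IsEfficient) (hsde : sde.IsEfficient) {γ γ' : ℕ → ℝ}
    (hγ : ∀ n, γ' n ≤ γ n) (h : sde.StrongAntiPiracyRand fe.encFamily γ') :
    (nested fe sde).ChallengeOnlyStrongAntiPiracy γ := by
  intro A hquery hrun
  obtain ⟨setup, hsetup, hsetup'⟩ := hfe.setup
  obtain ⟨kg, hkg, hkg'⟩ := hfe.kg
  obtain ⟨Q, hQ, hQ'⟩ := hsde.qkg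
  obtain ⟨_, hdec, _⟩ := hsde.dec
  obtain ⟨_, _, henc⟩ := hfe.enc
  obtain ⟨_, _, henc'⟩ := hsde.enc
  -- Positivity of the quantum key is not part of the definition of a scheme; it follows because the
  -- key is the output of a circuit.
  have hqkg : ∀ n k, (sde.qkg n k).PosSemidef := fun n k => by
    rw [← hQ']
    exact (QCirc.isCP _).posSemidef (posSemidef_ket k)
  have hafter : Efficient fun n => afterQuery (dk := sde.dk n) (st := A.st n) (kg n) (A.run n) :=
    ((Efficient.id.par .assoc).seq .assocInv).seq
      ((hkg'.efficient.par .id).seq (Efficient.exch.seq hrun.efficient))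
  have hB : Efficient (reductionPirate A setup kg).run :=
    (Efficient.unitLInv.seq (hsetup'.efficient.par .id)).seq <|
    -- Copying `fe.pk` is the one added operation whose cost depends on a width, which is bounded
    -- through the input register of PKFE encryption.
    (((Efficient.dup henc.polyWidth.left).par .id).par .id).seq <|
    (Efficient.assoc.seq .assoc).seq <|
    (Efficient.id.par (Efficient.exch.seq (Efficient.id.par .assocInv))).seq <|
    (Efficient.id.par ((Efficient.id.par (hquery.efficient.par .id)).seq hafter)).seq <|
    Efficient.assocInv.seq <|
    (Efficient.exch.seq (Efficient.id.par .exch)).par .id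
  -- The input registers `sde.pk` and `dk` have polynomial width because they are inputs of
  -- efficient SDE encryption and decryption.
  have hneg := h _ (hB.isQPT (henc'.polyWidth.left.tensor hdec.polyWidth.right))
  refine hneg.trans_abs_le fun n => ?_
  obtain ⟨h₀, h₁⟩ := winProb_nonneg_and_le_winProb_reductionPirate (A := A) hsetup hkg hqkg n (hγ n)
  rw [abs_of_nonneg h₀, abs_of_nonneg (h₀.trans h₁)]
  exact h₁

end QCrypto

end

theorem mainTheorem9 (𝓕 : QCrypto.FunClass) (C : ℕ → QCrypto.Wires)
    (fe : QCrypto.PKFE 𝓕 C) (sde : QCrypto.SDE C)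
    (hfe : fe.IsEfficient) (hsde : sde.IsEfficient)
    (γ γ' : ℕ → ℝ) (hγ : ∀ n, 0 ≤ γ' n ∧ γ' n ≤ γ n ∧ γ n ≤ 1)
    (h : sde.StrongAntiPiracyRand fe.encFamily γ') :
    (QCrypto.nested fe sde).ChallengeOnlyStrongAntiPiracy γ :=
  QCrypto.nested_challengeOnlyStrongAntiPiracy hfe hsde (fun n => (hγ n).2.1) h
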